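/- Fix a countably infinite set $\mathbb{A}$ of names, the group $G$ of finite permutations of $\mathbb{A}$, and a finite signature $\Sigma$ of operation symbols $f/n$ with finite arities. For a nominal set $X$, $\langle a\rangle x$ denotes the class of $(a,x)$ in $[\mathbb{A}]X$, the quotient of $\mathbb{A}\times X$ by $(a,x)\sim(b,y)$ iff $(c\,a)\cdot x=(c\,b)\cdot y$ for $c$ fresh for $(a,x,b,y)$. Terms are given by $t::=a.f(t_1,\dots,t_n)\mid \nu a.f(t_1,\dots,t_n)$ with $a\in\mathbb{A}$, $f/n\in\Sigma$; $\equiv_\alpha$ is the least congruence on terms with $\nu a.f(t_1,\dots,t_n)\equiv_\alpha\nu b.f(t_1',\dots,t_n')$ whenever $\langle a\rangle(t_1,\dots,t_n)=\langle b\rangle(t_1',\dots,t_n')$. A *regular nominal tree automaton* (RNTA) $A=(Q,\Delta,q_0)$ consists of an orbit-finite nominal set $Q$ of states, an initial state $q_0\in Q$, and an equivariant set $\Delta$ of rewrite rules $q(\gamma.f(x_1,\dots,x_n))\to\gamma.f(q_1(x_1),\dots,q_n(x_n))$ with $\gamma\in\{a,\nu a\mid a\in\mathbb{A}\}$, such that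 (i) if $\langle a\rangle(q_1,\dots,q_n)=\langle b\rangle(q_1',\dots,q_n')$ and $q(\nu a.f(x_1,\dots,x_n))\to\nu a.f(q_1(x_1),\dots,q_n(x_n))$ is in $\Delta$, then so is $q(\nu b.f(x_1,\dots,x_n))\to\nu b.f(q_1'(x_1),\dots,q_n'(x_n))$; and (ii) for all $q$ and $f/n$, the set of pairs $(a,(q_1,\dots,q_n))$ with $q(a.f(x_1,\dots,x_n))\to a.f(q_1(x_1),\dots,q_n(x_n))$ and the set of classes $\langle a\rangle(q_1,\dots,q_n)$ with $q(\nu a.f(x_1,\dots,x_n))\to\nu a.f(q_1(x_1),\dots,q_n(x_n))$ are finite. Its literal language $L(A)$ is the set of terms $t$ such that $q_0(t)$ rewrites to $t$ in finitely many steps (rules being applied inside contexts), its alphatic language is $L_\alpha(A)=\{[t]_\alpha\mid t\in L(A)\}$, and its degree is the maximal cardinality of supports of its states. Let $A=(Q,\Delta,q_0)$ be an RNTA with $Q=\sum_{i\in I}\mathbb{A}^{\#X_i}$ a strong nominal set, where the $X_i$ are finite sets and $\mathbb{A}^{\#X_i}$ is the set of injective maps $X_i\to\mathbb{A}$. For $q=(i,r)\in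 Q$ and $N\subseteq\mathrm{supp}(q)$ let $q|_N=(i,r|_N)$, where $r|_N$ is the partial injective map with $r|_N(x)=r(x)$ if $r(x)\in N$ and undefined otherwise. The *name-dropping modification* $A_\bot=(Q_\bot,\Delta_\bot,q_0)$ has state set $Q_\bot=\sum_{i\in I}\mathbb{A}^{\$X_i}$, where $\mathbb{A}^{\$X_i}$ is the set of partial injective maps from $X_i$ to $\mathbb{A}$, and exactly the following rules, for $q,q_1',\dots,q_n'\in Q$ and $N\subseteq\mathrm{supp}(q)$: 1. if $q(a.f(x_1,\dots,x_n))\to a.f(q_1'(x_1),\dots,q_n'(x_n))$ in $A$, $a\in N$ and $N_i\subseteq\mathrm{supp}(q_i')\cap N$ for all $i$, then $q|_N(a.f(x_1,\dots,x_n))\to a.f(q_1'|_{N_1}(x_1),\dots,q_n'|_{N_n}(x_n))$; 2. if $q(\nu a.f(x_1,\dots,x_n))\to\nu a.f(q_1'(x_1),\dots,q_n'(x_n))$ in $A$, $N_i\subseteq\mathrm{supp}(q_i')\cap(N\cup\{a\})$ and $\langle a\rangle(q_i'|_{N_i})=\langle b\rangle q_i''$ for all $i$, then $q|_N(\nu b.f(x_1,\dots,x_n))\to\nu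 b.f(q_1''(x_1),\dots,q_n''(x_n))$. **Theorem.** (a) For every RNTA $A$ whose states form a strong nominal set, $A_\bot$ is an RNTA; its literal language is the closure of the literal language of $A$ under $\alpha$-equivalence, $L(A_\bot)=\{t\mid \exists s\in L(A).\ s\equiv_\alpha t\}$; $L_\alpha(A_\bot)=L_\alpha(A)$; $A_\bot$ has the same degree $d$ as $A$; and the number of orbits of $Q_\bot$ is at most $2^d$ times the number of orbits of $Q$. (b) For every RNTA $A$ with arbitrary state set $Q$ there is an RNTA $A'$ whose states form a strong nominal set such that $L(A')=L(A)$, and such that $A'_\bot$ is an RNTA with $L(A'_\bot)=\{t\mid \exists s\in L(A).\ s\equiv_\alpha t\}$, $L_\alpha(A'_\bot)=L_\alpha(A)$, the same degree $d$ as $A$, and at most $2^d$ times as many orbits of states as $A$. -/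

import Mathlib

namespace NomTree

universe u v w

/-! ### Finite permutations, supports, nominal sets -/

/-- The group `G` of finite permutations of the set `𝔸` of names. -/
def finPerm (𝔸 : Type u) : Subgroup (Equiv.Perm 𝔸) where
  carrier := {π | {a | π a ≠ a}.Finite}
  one_mem' := by simp
  mul_mem' := by
    intro π σ hπ hσ
    refine Set.Finite.subset (Set.Finite.union hπ hσ) ?_
    intro a ha
    by_contra h
    simp only [Set.mem_union, Set.mem_ofPred_eq, not_or, not_not] at h
    exact ha (by rw [Equiv.Perm.mul_apply, h.2, h.1])
  inv_mem' := by
    intro π hπ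
    refine Set.Finite.subset hπ ?_
    intro a ha h
    exact ha (by rw [Equiv.Perm.inv_eq_iff_eq]; exact h.symm)

abbrev FinPerm (𝔸 : Type u) : Type u := ↥(finPerm 𝔸)

open Classical in
/-- The transposition `(a b)` as a finite permutation. -/
noncomputable def swp {𝔸 : Type u} (a b : 𝔸) : FinPerm 𝔸 :=
  ⟨Equiv.swap a b, by
    refine Set.Finite.subset (Set.toFinite {a, b}) ?_
    intro c hc
    by_contra h
    simp only [Set.mem_insert_iff, Set.mem_singleton_iff, not_or] at h
    exact hc (Equiv.swap_apply_of_ne_of_ne h.1 h.2)⟩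

/-- `X` is a nominal set: every element has a finite support. -/
def IsNominal (𝔸 : Type u) (X : Type v) [MulAction (FinPerm 𝔸) X] : Prop :=
  ∀ x : X, ∃ S : Set 𝔸, S.Finite ∧ MulAction.Supports (FinPerm 𝔸) S x

/-- The support of `x`: the least finite support (the intersection of all finite supports). -/
def supp (𝔸 : Type u) {X : Type v} [MulAction (FinPerm 𝔸) X] (x : X) : Set 𝔸 :=
  ⋂₀ {S : Set 𝔸 | S.Finite ∧ MulAction.Supports (FinPerm 𝔸) S x}

/-- The set of orbits of `X`. -/
abbrev Orbits (𝔸 : Type u) (X : Type v) [MulAction (FinPerm 𝔸) X] : Type v :=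
  MulAction.orbitRel.Quotient (FinPerm 𝔸) X

/-- `d` is the maximal cardinality of supports of elements of `X`. -/
def HasDegree (𝔸 : Type u) (X : Type v) [MulAction (FinPerm 𝔸) X] (d : ℕ) : Prop :=
  IsGreatest (Set.range fun x : X => (supp 𝔸 x).encard) (d : ℕ∞)

/-! ### Name abstraction -/

/-- `(a, x) ∼ (b, y)` iff `(c a) • x = (c b) • y` for a name `c` fresh for `(a, x, b, y)`. -/
def AbsRel (𝔸 : Type u) (X : Type v) [MulAction (FinPerm 𝔸) X] (p q : 𝔸 × X) : Prop :=
  ∃ c : 𝔸, c ∉ supp 𝔸 (p.1, p.2, q.1, q.2) ∧ swp c p.1 • p.2 = swp c q.1 • q.2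

/-- The abstraction set `[𝔸]X`, the quotient of `𝔸 × X` by `∼` (on nominal sets over an infinite
set of names, `∼` is an equivalence relation). -/
def Abs (𝔸 : Type u) (X : Type v) [MulAction (FinPerm 𝔸) X] : Type (max u v) :=
  Quot (AbsRel 𝔸 X)

/-- The element `⟨a⟩x` of `[𝔸]X`. -/
def absn {𝔸 : Type u} {X : Type v} [MulAction (FinPerm 𝔸) X] (a : 𝔸) (x : X) : Abs 𝔸 X :=
  Quot.mk _ (a, x)

/-! ### Terms and α-equivalence -/

/-- Labels: a free name `a`, or a name allocation `νa`. -/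
inductive Bar (𝔸 : Type u) : Type u
  | free (a : 𝔸) : Bar 𝔸
  | nu (a : 𝔸) : Bar 𝔸

def Bar.perm {𝔸 : Type u} (π : FinPerm 𝔸) : Bar 𝔸 → Bar 𝔸
  | .free a => .free (π • a)
  | .nu a => .nu (π • a)

instance {𝔸 : Type u} : MulAction (FinPerm 𝔸) (Bar 𝔸) where
  smul := Bar.perm
  one_smul := by rintro (a | a) <;> simp [HSMul.hSMul, Bar.perm] <;> rfl
  mul_smul := by rintro π σ (a | a) <;> rfl

/-- Nominal terms over the signature with symbols `F` and arities `ar`. -/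
inductive Tm (𝔸 : Type u) {F : Type v} (ar : F → ℕ) : Type (max u v)
  | node (γ : Bar 𝔸) (f : F) (ts : Fin (ar f) → Tm 𝔸 ar) : Tm 𝔸 ar

def Tm.perm {𝔸 : Type u} {F : Type v} {ar : F → ℕ} (π : FinPerm 𝔸) : Tm 𝔸 ar → Tm 𝔸 ar
  | .node γ f ts => .node (π • γ) f (fun i => (ts i).perm π)

instance {𝔸 : Type u} {F : Type v} {ar : F → ℕ} : MulAction (FinPerm 𝔸) (Tm 𝔸 ar) where
  smul := Tm.perm
  one_smul := by
    intro t
    change Tm.perm 1 t = t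
    induction t with
    | node γ f ts ih => simp only [Tm.perm, one_smul, ih]
  mul_smul := by
    intro π σ t
    change Tm.perm (π * σ) t = Tm.perm π (Tm.perm σ t)
    induction t with
    | node γ f ts ih => simp only [Tm.perm, mul_smul, ih]

/-- α-equivalence: the least congruence that identifies `νa.f(t₁,…,tₙ)` and `νb.f(t₁',…,tₙ')`
whenever `⟨a⟩(t₁,…,tₙ) = ⟨b⟩(t₁',…,tₙ')`. -/
inductive AlphaEq {𝔸 : Type u} {F : Type v} {ar : F → ℕ} : Tm 𝔸 ar → Tm 𝔸 ar → Prop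
  | rename (a b : 𝔸) (f : F) (ts ts' : Fin (ar f) → Tm 𝔸 ar) (h : absn a ts = absn b ts') :
      AlphaEq (.node (.nu a) f ts) (.node (.nu b) f ts')
  | congr (γ : Bar 𝔸) (f : F) (ts ts' : Fin (ar f) → Tm 𝔸 ar) (h : ∀ i, AlphaEq (ts i) (ts' i)) :
      AlphaEq (.node γ f ts) (.node γ f ts')
  | refl (t : Tm 𝔸 ar) : AlphaEq t t
  | symm {s t : Tm 𝔸 ar} (h : AlphaEq s t) : AlphaEq t s
  | trans {s t r : Tm 𝔸 ar} (h : AlphaEq s t) (h' : AlphaEq t r) : AlphaEq s r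

def alphaSetoid (𝔸 : Type u) {F : Type v} (ar : F → ℕ) : Setoid (Tm 𝔸 ar) where
  r := AlphaEq
  iseqv := ⟨AlphaEq.refl, AlphaEq.symm, AlphaEq.trans⟩

/-- Terms modulo α-equivalence. -/
abbrev AlphaTm (𝔸 : Type u) {F : Type v} (ar : F → ℕ) : Type (max u v) :=
  Quotient (alphaSetoid 𝔸 ar)

/-- The closure of a literal tree language under α-equivalence. -/
def alphaClosure {𝔸 : Type u} {F : Type v} {ar : F → ℕ} (L : Set (Tm 𝔸 ar)) : Set (Tm 𝔸 ar) :=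
  {t | ∃ s ∈ L, AlphaEq s t}

/-! ### Regular nominal tree automata -/

/-- The data of a tree automaton with state set `Q`; `Δ q γ f qs` is the rewrite rule
`q(γ.f(x₁,…,xₙ)) → γ.f(qs₁(x₁),…,qsₙ(xₙ))`. -/
structure TreeAut (𝔸 : Type u) {F : Type v} (ar : F → ℕ) (Q : Type w) where
  Δ : Q → Bar 𝔸 → (f : F) → (Fin (ar f) → Q) → Prop
  init : Q

/-- Extended terms, in which states may be applied to ground terms. -/
inductive ETm (𝔸 : Type u) {F : Type v} (ar : F → ℕ) (Q : Type w) : Type (max u v w)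
  | st (q : Q) (t : Tm 𝔸 ar) : ETm 𝔸 ar Q
  | node (γ : Bar 𝔸) (f : F) (es : Fin (ar f) → ETm 𝔸 ar Q) : ETm 𝔸 ar Q

/-- A term as an extended term without states. -/
def Tm.toETm {𝔸 : Type u} {F : Type v} {ar : F → ℕ} (Q : Type w) : Tm 𝔸 ar → ETm 𝔸 ar Q
  | .node γ f ts => .node γ f (fun i => (ts i).toETm Q)

section
variable {𝔸 : Type u} {F : Type v} {ar : F → ℕ} {Q : Type w}

/-- One application of a rewrite rule within a context. -/
inductive TreeAut.Step (A : TreeAut 𝔸 ar Q) : ETm 𝔸 ar Q → ETm 𝔸 ar Q → Prop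
  | rule (q : Q) (γ : Bar 𝔸) (f : F) (qs : Fin (ar f) → Q) (ts : Fin (ar f) → Tm 𝔸 ar)
      (h : A.Δ q γ f qs) :
      A.Step (.st q (.node γ f ts)) (.node γ f (fun i => .st (qs i) (ts i)))
  | ctx (γ : Bar 𝔸) (f : F) (es : Fin (ar f) → ETm 𝔸 ar Q) (i : Fin (ar f)) (e' : ETm 𝔸 ar Q)
      (h : A.Step (es i) e') :
      A.Step (.node γ f es) (.node γ f (Function.update es i e'))

/-- The state `q` accepts `t` if there is a run from `q(t)` to `t`. -/
def TreeAut.Accepts (A : TreeAut 𝔸 ar Q) (q : Q) (t : Tm 𝔸 ar) : Prop :=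
  Relation.ReflTransGen A.Step (.st q t) (t.toETm Q)

/-- The literal tree language. -/
def TreeAut.lang (A : TreeAut 𝔸 ar Q) : Set (Tm 𝔸 ar) :=
  {t | A.Accepts A.init t}

/-- The alphatic tree language. -/
def TreeAut.alphaLang (A : TreeAut 𝔸 ar Q) : Set (AlphaTm 𝔸 ar) :=
  Quotient.mk (alphaSetoid 𝔸 ar) '' A.lang

/-- `A` is a regular nominal tree automaton. -/
structure TreeAut.IsRNTA [MulAction (FinPerm 𝔸) Q] (A : TreeAut 𝔸 ar Q) : Prop where
  nominal : IsNominal 𝔸 Q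
  orbitFinite : Finite (Orbits 𝔸 Q)
  equivariant : ∀ (π : FinPerm 𝔸) (q : Q) (γ : Bar 𝔸) (f : F) (qs : Fin (ar f) → Q),
    A.Δ q γ f qs → A.Δ (π • q) (π • γ) f (π • qs)
  alphaInvariant : ∀ (q : Q) (a b : 𝔸) (f : F) (qs qs' : Fin (ar f) → Q),
    absn a qs = absn b qs' → A.Δ q (.nu a) f qs → A.Δ q (.nu b) f qs'
  finiteFree : ∀ (q : Q) (f : F), {p : 𝔸 × (Fin (ar f) → Q) | A.Δ q (.free p.1) f p.2}.Finite
  finiteBound : ∀ (q : Q) (f : F),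
    {z : Abs 𝔸 (Fin (ar f) → Q) | ∃ a qs, A.Δ q (.nu a) f qs ∧ absn a qs = z}.Finite

end

/-! ### Partial injective maps and the name-dropping modification -/

/-- Partial injective maps from `X` to `𝔸`, with `none` as the undefined value. -/
@[ext]
structure PInj (𝔸 : Type u) (X : Type v) where
  toFun : X → Option 𝔸
  inj : ∀ (x y : X) (a : 𝔸), toFun x = some a → toFun y = some a → x = y

instance {𝔸 : Type u} {X : Type v} : MulAction (FinPerm 𝔸) (PInj 𝔸 X) where
  smul π r :=
    { toFun := fun x => (r.toFun x).map (fun a => π • a)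
      inj := by
        intro x y a hx hy
        obtain ⟨b, hb, hb'⟩ := Option.map_eq_some_iff.1 hx
        obtain ⟨c, hc, hc'⟩ := Option.map_eq_some_iff.1 hy
        have hbc : b = c := MulAction.injective π (hb'.trans hc'.symm)
        exact r.inj x y b hb (hbc ▸ hc) }
  one_smul r := by
    apply PInj.ext
    funext x
    change (r.toFun x).map (fun a => (1 : FinPerm 𝔸) • a) = r.toFun x
    simp
  mul_smul π σ r := by
    apply PInj.ext
    funext x
    change (r.toFun x).map (fun a => (π * σ) • a)
      = ((r.toFun x).map (fun a => σ • a)).map (fun a => π • a)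
    simp [Option.map_map, Function.comp_def, mul_smul]

/-- A total injective map as a partial one. -/
def PInj.ofEmb {𝔸 : Type u} {X : Type v} (r : X ↪ 𝔸) : PInj 𝔸 X where
  toFun x := some (r x)
  inj _ _ _ hx hy := r.injective ((Option.some.inj hx).trans (Option.some.inj hy).symm)

open Classical in
/-- The restriction of `r` to the set `N` of names: `x ↦ r x` if `r x ∈ N`, undefined otherwise. -/
noncomputable def PInj.restrict {𝔸 : Type u} {X : Type v} (r : PInj 𝔸 X) (N : Set 𝔸) :
    PInj 𝔸 X where
  toFun x := (r.toFun x).filter (fun a => decide (a ∈ N))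
  inj x y a hx hy :=
    r.inj x y a (Option.filter_eq_some_iff.1 hx).1 (Option.filter_eq_some_iff.1 hy).1

/-- The strong nominal set `∑ i, 𝔸^{#X i}` of total injective maps. -/
abbrev Strong (𝔸 : Type u) {I : Type v} (X : I → Type w) : Type (max u v w) :=
  Σ i : I, (X i ↪ 𝔸)

/-- The nominal set `∑ i, 𝔸^{$X i}` of partial injective maps. -/
abbrev Partial (𝔸 : Type u) {I : Type v} (X : I → Type w) : Type (max u v w) :=
  Σ i : I, PInj 𝔸 (X i)

section
variable {𝔸 : Type u} {I : Type v} {X : I → Type w}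

/-- `q|_N = (i, r|_N)` for `q = (i, r)`. -/
noncomputable def Strong.restrict (q : Strong 𝔸 X) (N : Set 𝔸) : Partial 𝔸 X :=
  ⟨q.1, (PInj.ofEmb q.2).restrict N⟩

/-- The inclusion of total into partial injective maps. -/
def Strong.toPartial (q : Strong 𝔸 X) : Partial 𝔸 X :=
  ⟨q.1, PInj.ofEmb q.2⟩

variable {F : Type*} {ar : F → ℕ}

/-- The transitions of the name-dropping modification. -/
inductive NameDropRule (A : TreeAut 𝔸 ar (Strong 𝔸 X)) :
    Partial 𝔸 X → Bar 𝔸 → (f : F) → (Fin (ar f) → Partial 𝔸 X) → Prop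
  | free (f : F) (q : Strong 𝔸 X) (q' : Fin (ar f) → Strong 𝔸 X) (N : Set 𝔸)
      (Ns : Fin (ar f) → Set 𝔸) (a : 𝔸)
      (hN : N ⊆ supp 𝔸 q) (hNs : ∀ i, Ns i ⊆ supp 𝔸 (q' i) ∩ N) (ha : a ∈ N)
      (h : A.Δ q (.free a) f q') :
      NameDropRule A (q.restrict N) (.free a) f (fun i => (q' i).restrict (Ns i))
  | bound (f : F) (q : Strong 𝔸 X) (q' : Fin (ar f) → Strong 𝔸 X) (N : Set 𝔸)
      (Ns : Fin (ar f) → Set 𝔸) (a b : 𝔸) (q'' : Fin (ar f) → Partial 𝔸 X)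
      (hN : N ⊆ supp 𝔸 q) (hNs : ∀ i, Ns i ⊆ supp 𝔸 (q' i) ∩ (N ∪ {a}))
      (h : A.Δ q (.nu a) f q')
      (hq : ∀ i, absn a ((q' i).restrict (Ns i)) = absn b (q'' i)) :
      NameDropRule A (q.restrict N) (.nu b) f q''

/-- The name-dropping modification `A_⊥` of `A`. -/
def TreeAut.nameDrop (A : TreeAut 𝔸 ar (Strong 𝔸 X)) : TreeAut 𝔸 ar (Partial 𝔸 X) where
  Δ := NameDropRule A
  init := A.init.toPartial

end

end NomTree

/-! The literal language of `A` may miss an α-variant because a bound name `a` can be renamed to `b`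
only if `b` is fresh for the child states, whereas α-equivalence asks only that `b` be fresh for the
free names of the subterms. Every accepted term has its free names in the support of its state
(`TreeAut.IsRNTA.freeNames_subset_supp`), so a state may forget all names that do not occur free
below, and then nothing blocks the renaming.

The precise invariant is that `q|_N` accepts `t` iff the free names of `t` lie in `N` and `t` is
α-equivalent to a term accepted by `q`: `exists_run_of_run_nameDrop` and `run_nameDrop_of_alphaRel`.
Applied to `q₀ = q₀|_{supp q₀}` it gives the language equation.

Condition (ii) bounds the supports of the child states (`TreeAut.IsRNTA.supp_free`,
`TreeAut.IsRNTA.supp_nu`); conversely such bounds give (ii) for strong sets and for sets of partial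
maps, where a finite set of names supports only finitely many elements. An orbit of partial maps is
determined by an index `i` and a domain in `X i`, whence the factor `2 ^ d`.

For (b), `exists_strong_cover` presents the states as a support-preserving equivariant image of a
strong set with as many orbits, and the rules are pulled back along it. -/

namespace NomTree

universe u v w

/-! ### Transpositions and least supports -/

section Nominal
variable {𝔸 : Type u} {X : Type v} [MulAction (FinPerm 𝔸) X]

@[simp] theorem swp_smul_left (a b : 𝔸) : swp a b • a = b := by
  classical exact Equiv.swap_apply_left a b

@[simp] theorem swp_smul_right (a b : 𝔸) : swp a b • b = a := by
  classical exact Equiv.swap_apply_right a b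

theorem swp_smul_of_ne {a b c : 𝔸} (ha : c ≠ a) (hb : c ≠ b) : swp a b • c = c := by
  classical exact Equiv.swap_apply_of_ne_of_ne ha hb

theorem finPerm_ext {π σ : FinPerm 𝔸} (h : ∀ a : 𝔸, π • a = σ • a) : π = σ :=
  Subtype.ext (Equiv.ext h)

theorem swp_smul_eq_ite [DecidableEq 𝔸] (a b c : 𝔸) :
    swp a b • c = if c = a then b else if c = b then a else c := by
  split_ifs with h₁ h₂
  · rw [h₁, swp_smul_left]
  · rw [h₂, swp_smul_right]
  · exact swp_smul_of_ne h₁ h₂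

@[simp] theorem swp_self (a : 𝔸) : swp a a = 1 := by
  refine finPerm_ext fun c => ?_
  classical
  rw [swp_smul_eq_ite, one_smul]; split_ifs <;> simp_all

@[simp] theorem swp_mul_self (a b : 𝔸) : swp a b * swp a b = 1 := by
  classical exact Subtype.ext (Equiv.swap_mul_self a b)

@[simp] theorem swp_inv (a b : 𝔸) : (swp a b)⁻¹ = swp a b :=
  inv_eq_of_mul_eq_one_left (swp_mul_self a b)

@[simp] theorem swp_smul_swp_smul (a b : 𝔸) (x : X) : swp a b • swp a b • x = x := by
  rw [← mul_smul, swp_mul_self, one_smul]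

theorem mul_swp (π : FinPerm 𝔸) (a b : 𝔸) : π * swp a b = swp (π • a) (π • b) * π := by
  refine finPerm_ext fun c => ?_
  classical
  simp only [mul_smul, swp_smul_eq_ite, smul_left_cancel_iff]
  split_ifs <;> rfl

theorem smul_swp_smul (π : FinPerm 𝔸) (a b : 𝔸) (x : X) :
    π • swp a b • x = swp (π • a) (π • b) • π • x := by
  rw [← mul_smul, mul_swp, mul_smul]

theorem swp_smul_eq_of_supports {S : Set 𝔸} {x : X} (h : MulAction.Supports (FinPerm 𝔸) S x)
    {c d : 𝔸} (hc : c ∉ S) (hd : d ∉ S) : swp c d • x = x :=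
  h _ fun _ ha => swp_smul_of_ne (ne_of_mem_of_not_mem ha hc) (ne_of_mem_of_not_mem ha hd)

theorem exists_notMem_of_finite [Infinite 𝔸] {S : Set 𝔸} (hS : S.Finite) : ∃ c, c ∉ S :=
  hS.infinite_compl.nonempty

theorem exists_supports_of_notMem_supp {x : X} {c : 𝔸} (hc : c ∉ supp 𝔸 x) :
    ∃ S : Set 𝔸, S.Finite ∧ MulAction.Supports (FinPerm 𝔸) S x ∧ c ∉ S := by
  simp only [supp, Set.mem_sInter, not_forall] at hc
  obtain ⟨S, ⟨h₁, h₂⟩, h₃⟩ := hc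
  exact ⟨S, h₁, h₂, h₃⟩

theorem supp_subset_of_supports {S : Set 𝔸} {x : X} (hS : S.Finite)
    (h : MulAction.Supports (FinPerm 𝔸) S x) : supp 𝔸 x ⊆ S :=
  Set.sInter_subset_of_mem ⟨hS, h⟩

theorem IsNominal.finite_supp (hX : IsNominal 𝔸 X) (x : X) : (supp 𝔸 x).Finite := by
  obtain ⟨S, hS, h⟩ := hX x
  exact hS.subset (supp_subset_of_supports hS h)

/-- The finite supports omitting `c` and `d` may differ, so the swap is factored through a third
name `e` outside both: `(c d)` is `(e d)` conjugated by `(c e)`. -/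
theorem swp_smul_eq_of_notMem_supp [Infinite 𝔸] {x : X} {c d : 𝔸} (hc : c ∉ supp 𝔸 x)
    (hd : d ∉ supp 𝔸 x) : swp c d • x = x := by
  obtain ⟨S, hS, hSx, hcS⟩ := exists_supports_of_notMem_supp hc
  obtain ⟨T, hT, hTx, hdT⟩ := exists_supports_of_notMem_supp hd
  obtain ⟨e, he⟩ := exists_notMem_of_finite ((hS.union hT).union (Set.toFinite {c, d}))
  simp only [Set.mem_union, Set.mem_insert_iff, Set.mem_singleton_iff, not_or] at he
  obtain ⟨⟨heS, heT⟩, hec, hed⟩ := he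
  by_cases hcd : c = d
  · rw [hcd, swp_self, one_smul]
  · have h := smul_swp_smul (swp c e) e d x
    rwa [swp_smul_right, swp_smul_of_ne (Ne.symm hcd) (Ne.symm hed),
      swp_smul_eq_of_supports hTx heT hdT, swp_smul_eq_of_supports hSx hcS heS, eq_comm] at h

/-- A finite permutation that fixes `supp x` pointwise is a product of transpositions
of names outside `supp x`. -/
theorem smul_eq_of_forall_mem_supp [Infinite 𝔸] {x : X} (π : FinPerm 𝔸)
    (h : ∀ a ∈ supp 𝔸 x, π • a = a) : π • x = x := by
  obtain ⟨n, hn⟩ : ∃ n, {a : 𝔸 | π • a ≠ a}.ncard = n := ⟨_, rfl⟩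
  induction n using Nat.strong_induction_on generalizing π with
  | _ n ih =>
  have hfin : {a : 𝔸 | π • a ≠ a}.Finite := π.2
  by_cases hπ : ∃ a : 𝔸, π • a ≠ a
  · obtain ⟨a, ha⟩ := hπ
    have haS : a ∉ supp 𝔸 x := fun h' => ha (h a h')
    have hbS : π • a ∉ supp 𝔸 x := fun h' => ha (smul_left_cancel π (h _ h'))
    -- Composing with `swp a (π • a)` fixes `a` and moves no new name, so the number of moved names
    -- drops.
    have hsub : {c : 𝔸 | (swp a (π • a) * π) • c ≠ c} ⊂ {c : 𝔸 | π • c ≠ c} := by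
      refine Set.ssubset_iff_of_subset ?_ |>.2 ⟨a, ha, by simp [mul_smul]⟩
      intro c hc hc'
      refine hc ?_
      rw [mul_smul, hc']
      refine swp_smul_of_ne ?_ ?_
      · rintro rfl; exact ha hc'
      · rintro rfl; exact ha (smul_left_cancel π hc')
    have := ih _ (hn ▸ Set.ncard_lt_ncard hsub hfin) (swp a (π • a) * π) (by
      intro c hc
      rw [mul_smul, h c hc]
      exact swp_smul_of_ne (ne_of_mem_of_not_mem hc haS) (ne_of_mem_of_not_mem hc hbS)) rfl
    rw [mul_smul] at this
    rw [← swp_inv, inv_smul_eq_iff] at this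
    rw [this, swp_smul_eq_of_notMem_supp haS hbS]
  · push Not at hπ
    rw [show π = 1 from finPerm_ext fun a => by rw [hπ, one_smul], one_smul]

theorem supp_supports [Infinite 𝔸] (x : X) : MulAction.Supports (FinPerm 𝔸) (supp 𝔸 x) x :=
  fun π h => smul_eq_of_forall_mem_supp π fun _ ha => h ha

theorem supports_smul {S : Set 𝔸} {x : X} (h : MulAction.Supports (FinPerm 𝔸) S x)
    (π : FinPerm 𝔸) : MulAction.Supports (FinPerm 𝔸) ((π • ·) '' S) (π • x) := by
  intro σ hσ
  have : (π⁻¹ * σ * π) • x = x := h _ fun a ha => by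
    rw [mul_smul, mul_smul, hσ ⟨a, ha, rfl⟩, inv_smul_smul]
  rw [mul_smul, mul_smul, inv_smul_eq_iff] at this
  exact this

theorem smul_mem_supp_smul {x : X} {a : 𝔸} (π : FinPerm 𝔸) (ha : a ∈ supp 𝔸 x) :
    π • a ∈ supp 𝔸 (π • x) := by
  rintro S ⟨hS, hSx⟩
  have h := supports_smul hSx π⁻¹
  rw [inv_smul_smul] at h
  obtain ⟨b, hb, hba⟩ := supp_subset_of_supports (hS.image _) h ha
  rwa [← hba, smul_inv_smul]

theorem supp_smul (π : FinPerm 𝔸) (x : X) : supp 𝔸 (π • x) = (π • ·) '' supp 𝔸 x := by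
  apply Set.Subset.antisymm
  · intro a ha
    have := smul_mem_supp_smul π⁻¹ ha
    rw [inv_smul_smul] at this
    exact ⟨_, this, smul_inv_smul π a⟩
  · rintro _ ⟨a, ha, rfl⟩
    exact smul_mem_supp_smul π ha

theorem image_subset_supp_smul {x : X} {N : Set 𝔸} (h : N ⊆ supp 𝔸 x) (π : FinPerm 𝔸) :
    (π • ·) '' N ⊆ supp 𝔸 (π • x) := by
  rintro _ ⟨a, ha, rfl⟩
  exact smul_mem_supp_smul π (h ha)

/-- If some finite support omits `a ∈ S`, swapping `a` with a name outside that support and `S`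
fixes `x`, against minimality. -/
theorem supp_eq_of_supports [Infinite 𝔸] {S : Set 𝔸} {x : X} (hS : S.Finite)
    (h : MulAction.Supports (FinPerm 𝔸) S x)
    (hmin : ∀ a ∈ S, ∀ d ∉ S, swp d a • x ≠ x) : supp 𝔸 x = S := by
  refine (supp_subset_of_supports hS h).antisymm fun a ha => ?_
  by_contra hax
  obtain ⟨T, hT, hTx, haT⟩ := exists_supports_of_notMem_supp hax
  obtain ⟨d, hd⟩ := exists_notMem_of_finite (hS.union hT)
  simp only [Set.mem_union, not_or] at hd
  exact hmin a ha d hd.1 (swp_smul_eq_of_supports hTx hd.2 haT)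

theorem IsNominal.pi {ι : Type w} [Finite ι] (hX : IsNominal 𝔸 X) : IsNominal 𝔸 (ι → X) := by
  intro xs
  choose S hS hSx using hX
  exact ⟨⋃ i, S (xs i), Set.finite_iUnion fun i => hS _, fun π hπ => funext fun i =>
    hSx _ π fun _ ha => hπ (Set.mem_iUnion_of_mem i ha)⟩

theorem isNominal_names : IsNominal 𝔸 𝔸 :=
  fun a => ⟨{a}, Set.finite_singleton a, fun _ h => h rfl⟩

theorem IsNominal.prod {Y : Type w} [MulAction (FinPerm 𝔸) Y] (hX : IsNominal 𝔸 X)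
    (hY : IsNominal 𝔸 Y) : IsNominal 𝔸 (X × Y) := by
  rintro ⟨x, y⟩
  obtain ⟨S, hS, hSx⟩ := hX x
  obtain ⟨T, hT, hTy⟩ := hY y
  exact ⟨S ∪ T, hS.union hT, fun π h =>
    Prod.ext (hSx π fun a ha => h (.inl ha)) (hTy π fun a ha => h (.inr ha))⟩

/-- A finite set that is stable under all transpositions of names outside `S` is supported by `S`
elementwise. -/
theorem supp_subset_of_finite_of_swp_mem [Infinite 𝔸] (hX : IsNominal 𝔸 X) {Z : Set X}
    (hZ : Z.Finite) {S : Set 𝔸} (hS : S.Finite)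
    (h : ∀ c ∉ S, ∀ d ∉ S, ∀ z ∈ Z, swp c d • z ∈ Z) {z : X} (hz : z ∈ Z) : supp 𝔸 z ⊆ S := by
  intro c hc
  by_contra hcS
  -- `d` avoids the supports of all elements of `Z`, yet swapping `c` with `d` yields an element of
  -- `Z` with `d` in its support.
  obtain ⟨d, hd⟩ := exists_notMem_of_finite
    (hS.union (hZ.biUnion fun z _ => hX.finite_supp z))
  simp only [Set.mem_union, Set.mem_iUnion, not_or, not_exists] at hd
  refine hd.2 _ (h c hcS d hd.1 z hz) ?_
  simpa using smul_mem_supp_smul (swp c d) hc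

theorem supp_apply_subset {ι : Type w} [Infinite 𝔸] (hX : IsNominal 𝔸 X) [Finite ι] (xs : ι → X)
    (i : ι) :
    supp 𝔸 (xs i) ⊆ supp 𝔸 xs :=
  supp_subset_of_supports (hX.pi.finite_supp xs) fun π h =>
    congrFun (supp_supports xs π h) i

end Nominal

/-! ### Name abstraction -/

section Abstraction
variable {𝔸 : Type u} [Infinite 𝔸] {X : Type v} [MulAction (FinPerm 𝔸) X]

/-- Equality of abstractions is agreement for all but finitely many names. -/
theorem absn_eq_iff (hX : IsNominal 𝔸 X) {a b : 𝔸} {x y : X} :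
    absn a x = absn b y ↔ ∃ S : Set 𝔸, S.Finite ∧ ∀ c ∉ S, swp c a • x = swp c b • y := by
  constructor
  · intro h
    -- Agreement at cofinitely many names is visibly transitive. It contains `AbsRel`, hence also
    -- the equivalence relation that `AbsRel` generates.
    let R : Setoid (𝔸 × X) :=
      { r := fun p q => ∃ S : Set 𝔸, S.Finite ∧ ∀ c ∉ S, swp c p.1 • p.2 = swp c q.1 • q.2
        iseqv := by
          refine ⟨fun p => ⟨∅, Set.finite_empty, fun _ _ => rfl⟩, ?_, ?_⟩
          · rintro p q ⟨S, hS, h⟩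
            exact ⟨S, hS, fun c hc => (h c hc).symm⟩
          · rintro p q r ⟨S, hS, h⟩ ⟨T, hT, h'⟩
            exact ⟨S ∪ T, hS.union hT, fun c hc =>
              (h c fun hc' => hc (.inl hc')).trans (h' c fun hc' => hc (.inr hc'))⟩ }
    have key : ∀ p q : 𝔸 × X, AbsRel 𝔸 X p q → R p q := by
      rintro ⟨a, x⟩ ⟨b, y⟩ ⟨c, hc, hxy⟩
      obtain ⟨S, hS, hSx, hcS⟩ := exists_supports_of_notMem_supp hc
      refine ⟨S ∪ {a, b}, hS.union (Set.toFinite _), fun d hd => ?_⟩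
      simp only [Set.mem_union, Set.mem_insert_iff, Set.mem_singleton_iff, not_or] at hd
      obtain ⟨hdS, hda, hdb⟩ := hd
      -- Swapping `d` and `c` carries the equation from the one fresh name `c` to `d`.
      have hswp := swp_smul_eq_of_supports hSx hdS hcS
      simp only [Prod.smul_mk, Prod.mk.injEq] at hswp
      obtain ⟨h₁, h₂, h₃, h₄⟩ := hswp
      have := congrArg (swp d c • ·) hxy
      simpa only [smul_swp_smul, swp_smul_right, h₁, h₂, h₃, h₄] using this
    have : Quot.lift (Quotient.mk R) (fun p q h => Quotient.sound (key p q h)) (absn a x)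
        = Quot.lift (Quotient.mk R) (fun p q h => Quotient.sound (key p q h)) (absn b y) := by
      rw [h]
    exact Quotient.exact this
  · rintro ⟨S, hS, h⟩
    have hnom : IsNominal 𝔸 (𝔸 × X × 𝔸 × X) :=
      isNominal_names.prod (hX.prod (isNominal_names.prod hX))
    obtain ⟨c, hc⟩ := exists_notMem_of_finite (hS.union (hnom.finite_supp (a, x, b, y)))
    simp only [Set.mem_union, not_or] at hc
    exact Quot.sound ⟨c, hc.2, h c hc.1⟩

theorem absn_injective (hX : IsNominal 𝔸 X) (a : 𝔸) :
    Function.Injective (absn a : X → Abs 𝔸 X) := by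
  intro x y h
  obtain ⟨S, hS, h⟩ := (absn_eq_iff hX).1 h
  obtain ⟨c, hc⟩ := exists_notMem_of_finite hS
  exact smul_left_cancel _ (h c hc)

/-- Renaming to `b` is sound when `b` is fresh for `x` or is `a` itself; the hypothesis on `b`
covers both cases. -/
theorem absn_swp_smul (hX : IsNominal 𝔸 X) {a b : 𝔸} {x : X} {S : Set 𝔸} (hS : S.Finite)
    (hSx : MulAction.Supports (FinPerm 𝔸) S x) (hb : b ∈ S → b = a) :
    absn a x = absn b (swp b a • x) := by
  by_cases hab : b = a
  · rw [hab, swp_self, one_smul]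
  refine (absn_eq_iff hX).2 ⟨S ∪ {a, b}, hS.union (Set.toFinite _), fun c hc => ?_⟩
  simp only [Set.mem_union, Set.mem_insert_iff, Set.mem_singleton_iff, not_or] at hc
  rw [smul_swp_smul, swp_smul_right, swp_smul_of_ne (Ne.symm hc.2.1) (Ne.symm hab),
    swp_smul_eq_of_supports hSx hc.1 (fun h => hab (hb h))]

theorem absn_apply {ι : Type w} [Finite ι] (hX : IsNominal 𝔸 X) {a b : 𝔸} {xs ys : ι → X}
    (h : absn a xs = absn b ys) (i : ι) : absn a (xs i) = absn b (ys i) := by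
  obtain ⟨S, hS, h⟩ := (absn_eq_iff hX.pi).1 h
  exact (absn_eq_iff hX).2 ⟨S, hS, fun c hc => congrFun (h c hc) i⟩

theorem absn_funext {ι : Type w} [Finite ι] (hX : IsNominal 𝔸 X) {a b : 𝔸} {xs ys : ι → X}
    (h : ∀ i, absn a (xs i) = absn b (ys i)) : absn a xs = absn b ys := by
  choose S hS h using fun i => (absn_eq_iff hX).1 (h i)
  exact (absn_eq_iff hX.pi).2 ⟨⋃ i, S i, Set.finite_iUnion hS, fun c hc => funext fun i =>
    h i c fun hc' => hc (Set.mem_iUnion_of_mem i hc')⟩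

theorem absn_map {Y : Type w} [MulAction (FinPerm 𝔸) Y] (hX : IsNominal 𝔸 X)
    (hY : IsNominal 𝔸 Y) (g : X → Y) (hg : ∀ (π : FinPerm 𝔸) x, g (π • x) = π • g x) {a b : 𝔸}
    {x y : X} (h : absn a x = absn b y) : absn a (g x) = absn b (g y) := by
  obtain ⟨S, hS, h⟩ := (absn_eq_iff hX).1 h
  exact (absn_eq_iff hY).2 ⟨S, hS, fun c hc => by rw [← hg, ← hg, h c hc]⟩

/-- If only finitely many elements of `X` have support in a given finite set, then only finitely
many abstractions do. -/
theorem finite_absn {ι : Type w} [Finite ι] (hX : IsNominal 𝔸 X)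
    (hfin : ∀ S : Set 𝔸, S.Finite → {x : X | supp 𝔸 x ⊆ S}.Finite) {S : Set 𝔸} (hS : S.Finite) :
    {z : Abs 𝔸 (ι → X) |
      ∃ a xs, (∀ i, supp 𝔸 (xs i) ⊆ S ∪ {a}) ∧ absn a xs = z}.Finite := by
  -- Bound names outside `S` can all be renamed to this one `c`; those in `S` are kept.
  obtain ⟨c, hc⟩ := exists_notMem_of_finite hS
  have hT : (S ∪ {c}).Finite := hS.union (Set.finite_singleton c)
  have hF : {xs : ι → X | ∀ i, xs i ∈ {x : X | supp 𝔸 x ⊆ S ∪ {c}}}.Finite :=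
    Set.Finite.pi' fun _ => hfin _ hT
  refine ((hT.prod hF).image fun p => absn p.1 p.2).subset ?_
  rintro _ ⟨a, xs, hxs, rfl⟩
  by_cases ha : a ∈ S
  · exact ⟨(a, xs), ⟨.inl ha, fun i => (hxs i).trans (Set.union_subset Set.subset_union_left
      (by simpa using .inr ha))⟩, rfl⟩
  · refine ⟨(c, swp c a • xs), ⟨.inr rfl, fun i => ?_⟩, ?_⟩
    · change supp 𝔸 (swp c a • xs i) ⊆ _
      rw [supp_smul]
      rintro _ ⟨b, hb, rfl⟩
      rcases hxs i hb with hb | rfl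
      · left
        change swp c a • b ∈ S
        rwa [swp_smul_of_ne (ne_of_mem_of_not_mem hb hc) (ne_of_mem_of_not_mem hb ha)]
      · right; simp
    · refine (absn_swp_smul hX.pi (S := S ∪ {a}) (hS.union (Set.finite_singleton a)) ?_ ?_).symm
      · exact fun π h => funext fun i => smul_eq_of_forall_mem_supp π fun b hb => h (hxs i hb)
      · simp [hc]

end Abstraction

/-! ### Extending injections to finite permutations -/

section Extension
variable {𝔸 : Type u} {X : Type v} [Finite X]

open Classical in
/-- Any two injections of a finite set into the names differ by a finite permutation. -/
theorem exists_smul_eq_of_injective {r s : X → 𝔸} (hr : r.Injective) (hs : s.Injective) :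
    ∃ π : FinPerm 𝔸, ∀ x, π • r x = s x := by
  have : Fintype X := Fintype.ofFinite X
  -- The bijection between the two images extends to a permutation of their union, which is then
  -- continued by the identity.
  let T : Finset 𝔸 := Finset.univ.image r ∪ Finset.univ.image s
  have hrT : ∀ x, r x ∈ T := fun x => by simp [T]
  have hsT : ∀ x, s x ∈ T := fun x => by simp [T]
  obtain ⟨σ, hσ⟩ := Equiv.Perm.exists_extending_pair
    (fun x => (⟨r x, hrT x⟩ : T)) (fun x => (⟨s x, hsT x⟩ : T))
    (fun x y h => hr (congrArg Subtype.val h)) (fun x y h => hs (congrArg Subtype.val h))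
  refine ⟨⟨σ.ofSubtype, T.finite_toSet.subset fun a ha => ?_⟩, fun x => ?_⟩
  · by_contra h
    exact ha (Equiv.Perm.ofSubtype_apply_of_not_mem σ h)
  · exact (Equiv.Perm.ofSubtype_apply_of_mem σ (hrT x)).trans (congrArg Subtype.val (hσ x))

end Extension

/-! ### Free names and α-equivalence -/

section Terms
variable {𝔸 : Type u} {F : Type v} {ar : F → ℕ}

@[simp] theorem smul_free (π : FinPerm 𝔸) (a : 𝔸) : π • Bar.free a = .free (π • a) := rfl

@[simp] theorem smul_nu (π : FinPerm 𝔸) (a : 𝔸) : π • Bar.nu a = .nu (π • a) := rfl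

@[simp] theorem smul_node (π : FinPerm 𝔸) (γ : Bar 𝔸) (f : F) (ts : Fin (ar f) → Tm 𝔸 ar) :
    π • Tm.node γ f ts = .node (π • γ) f (fun i => π • ts i) := rfl

theorem isNominal_tm : IsNominal 𝔸 (Tm 𝔸 ar) := by
  intro t
  induction t with
  | node γ f ts ih =>
  choose S hS hSt using ih
  obtain ⟨T, hT, hTγ⟩ : ∃ T : Set 𝔸, T.Finite ∧ MulAction.Supports (FinPerm 𝔸) T γ := by
    rcases γ with a | a <;>
    exact ⟨{a}, Set.finite_singleton a, fun π h => by
      simpa using h (Set.mem_singleton a)⟩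
  refine ⟨T ∪ ⋃ i, S i, hT.union (Set.finite_iUnion hS), fun π h => ?_⟩
  rw [smul_node, hTγ π fun _ ha => h (.inl ha)]
  congr 1
  exact funext fun i => hSt i π fun _ ha => h (.inr (Set.mem_iUnion_of_mem i ha))

/-- The free names of a term. -/
def Tm.freeNames : Tm 𝔸 ar → Set 𝔸
  | .node (.free a) _ ts => {a} ∪ ⋃ i, (ts i).freeNames
  | .node (.nu a) _ ts => (⋃ i, (ts i).freeNames) \ {a}

theorem freeNames_finite (t : Tm 𝔸 ar) : t.freeNames.Finite := by
  induction t with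
  | node γ f ts ih =>
  cases γ with
  | free a => exact (Set.finite_singleton a).union (Set.finite_iUnion ih)
  | nu a => exact (Set.finite_iUnion ih).subset Set.sdiff_subset

theorem freeNames_smul (π : FinPerm 𝔸) (t : Tm 𝔸 ar) :
    (π • t).freeNames = (π • ·) '' t.freeNames := by
  induction t with
  | node γ f ts ih =>
  cases γ with
  | free a => simp only [smul_node, smul_free, Tm.freeNames, ih, Set.image_union,
      Set.image_singleton, Set.image_iUnion]
  | nu a => simp only [smul_node, smul_nu, Tm.freeNames, ih,
      Set.image_sdiff (MulAction.injective π), Set.image_singleton, Set.image_iUnion]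

/-- α-equivalence, presented by recursion on the terms. -/
inductive AlphaRel : Tm 𝔸 ar → Tm 𝔸 ar → Prop
  | free (a : 𝔸) (f : F) (ts ts' : Fin (ar f) → Tm 𝔸 ar) (h : ∀ i, AlphaRel (ts i) (ts' i)) :
      AlphaRel (.node (.free a) f ts) (.node (.free a) f ts')
  | nu (a b : 𝔸) (f : F) (ts ts' : Fin (ar f) → Tm 𝔸 ar) (S : Set 𝔸) (hS : S.Finite)
      (h : ∀ c ∉ S, ∀ i, AlphaRel (swp c a • ts i) (swp c b • ts' i)) :
      AlphaRel (.node (.nu a) f ts) (.node (.nu b) f ts')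

theorem AlphaRel.smul {s t : Tm 𝔸 ar} (h : AlphaRel s t) (π : FinPerm 𝔸) :
    AlphaRel (π • s) (π • t) := by
  induction h with
  | free a f ts ts' h ih => exact .free _ _ _ _ ih
  | nu a b f ts ts' S hS h ih =>
    refine .nu _ _ _ _ _ ((π • ·) '' S) (hS.image _) fun c hc i => ?_
    have hc' : π⁻¹ • c ∉ S := fun h => hc ⟨_, h, smul_inv_smul π c⟩
    have := ih _ hc' i
    rwa [smul_swp_smul, smul_swp_smul, smul_inv_smul] at this

theorem AlphaRel.of_smul {s t : Tm 𝔸 ar} {π : FinPerm 𝔸} (h : AlphaRel (π • s) (π • t)) :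
    AlphaRel s t := by
  simpa using h.smul π⁻¹

theorem AlphaRel.refl (t : Tm 𝔸 ar) : AlphaRel t t := by
  induction t with
  | node γ f ts ih =>
  cases γ with
  | free a => exact .free _ _ _ _ ih
  | nu a => exact .nu _ _ _ _ _ ∅ Set.finite_empty fun c _ i => (ih i).smul _

theorem AlphaRel.symm {s t : Tm 𝔸 ar} (h : AlphaRel s t) : AlphaRel t s := by
  induction h with
  | free a f ts ts' h ih => exact .free _ _ _ _ ih
  | nu a b f ts ts' S hS h ih => exact .nu _ _ _ _ _ S hS ih

/-- Because the binder clause quantifies over cofinitely many fresh names, the two exceptional sets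
are simply united. -/
theorem AlphaRel.trans {s t r : Tm 𝔸 ar} (h : AlphaRel s t) (h' : AlphaRel t r) :
    AlphaRel s r := by
  induction h generalizing r with
  | free a f ts ts' h ih =>
    cases h' with
    | free _ _ _ ts'' h' => exact .free _ _ _ _ fun i => ih i (h' i)
  | nu a b f ts ts' S hS h ih =>
    cases h' with
    | nu _ d _ _ ts'' T hT h' =>
      exact .nu _ _ _ _ _ (S ∪ T) (hS.union hT) fun c hc i =>
        ih c (fun hc' => hc (.inl hc')) i (h' c (fun hc' => hc (.inr hc')) i)

theorem AlphaEq.alphaRel [Infinite 𝔸] {s t : Tm 𝔸 ar} (h : AlphaEq s t) : AlphaRel s t := by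
  induction h with
  | rename a b f ts ts' h =>
    obtain ⟨S, hS, h⟩ := (absn_eq_iff isNominal_tm.pi).1 h
    refine .nu _ _ _ _ _ S hS fun c hc i => ?_
    have : swp c a • ts i = swp c b • ts' i := congrFun (h c hc) i
    rw [this]
    exact .refl _
  | congr γ f ts ts' h ih =>
    cases γ with
    | free a => exact .free _ _ _ _ ih
    | nu a => exact .nu _ _ _ _ _ ∅ Set.finite_empty fun c _ i => (ih i).smul _
  | refl t => exact .refl t
  | symm h ih => exact ih.symm
  | trans h h' ih ih' => exact ih.trans ih'

/-- Both binders are renamed to a common fresh `c`, under which the children are related by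
congruence. -/
theorem AlphaRel.alphaEq [Infinite 𝔸] {s t : Tm 𝔸 ar} (h : AlphaRel s t) : AlphaEq s t := by
  induction h with
  | free a f ts ts' h ih => exact .congr _ _ _ _ ih
  | nu a b f ts ts' S hS h ih =>
    have hnom := (isNominal_tm (𝔸 := 𝔸) (ar := ar)).pi (ι := Fin (ar f))
    obtain ⟨c, hc⟩ := exists_notMem_of_finite
      (hS.union ((hnom.finite_supp ts).union (hnom.finite_supp ts')))
    simp only [Set.mem_union, not_or] at hc
    exact ((AlphaEq.rename _ _ _ _ _ (absn_swp_smul hnom (hnom.finite_supp ts) (supp_supports ts)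
      fun h => absurd h hc.2.1)).trans (.congr _ _ _ _ (ih c hc.1))).trans
      (.rename _ _ _ _ _ (absn_swp_smul hnom (hnom.finite_supp ts') (supp_supports ts')
      fun h => absurd h hc.2.2).symm)

theorem sdiff_subset_sdiff_of_swp_image {U V : Set 𝔸} {a b c : 𝔸} (hU : c ∉ U) (hV : c ∉ V)
    (h : (swp c a • ·) '' U = (swp c b • ·) '' V) : U \ {a} ⊆ V \ {b} := by
  rintro x ⟨hx, hxa⟩
  have hxc : x ≠ c := ne_of_mem_of_not_mem hx hU
  obtain ⟨y, hy, hyx⟩ : x ∈ (swp c b • ·) '' V := h ▸ ⟨x, hx, swp_smul_of_ne hxc hxa⟩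
  have hyc : y ≠ c := ne_of_mem_of_not_mem hy hV
  by_cases hyb : y = b
  · subst hyb
    exact absurd (hyx.symm.trans (swp_smul_right _ _)) hxc
  · have : y = x := (swp_smul_of_ne hyc hyb).symm.trans hyx
    subst this
    exact ⟨hy, hyb⟩

theorem AlphaRel.freeNames_eq [Infinite 𝔸] {s t : Tm 𝔸 ar} (h : AlphaRel s t) :
    s.freeNames = t.freeNames := by
  induction h with
  | free a f ts ts' h ih => simp only [Tm.freeNames, ih]
  | nu a b f ts ts' S hS h ih =>
    obtain ⟨c, hc⟩ := exists_notMem_of_finite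
      (hS.union ((Set.finite_iUnion fun i => freeNames_finite (ts i)).union
        (Set.finite_iUnion fun i => freeNames_finite (ts' i))))
    simp only [Set.mem_union, not_or] at hc
    have key : (swp c a • ·) '' (⋃ i, (ts i).freeNames)
        = (swp c b • ·) '' ⋃ i, (ts' i).freeNames := by
      simp only [Set.image_iUnion, ← freeNames_smul, ih c hc.1]
    exact (sdiff_subset_sdiff_of_swp_image hc.2.1 hc.2.2 key).antisymm
      (sdiff_subset_sdiff_of_swp_image hc.2.2 hc.2.1 key.symm)

/-- A permutation that fixes the free names of a term maps it to an α-equivalent one. -/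
theorem alphaRel_smul_self [Infinite 𝔸] (t : Tm 𝔸 ar) (π : FinPerm 𝔸)
    (h : ∀ a ∈ t.freeNames, π • a = a) : AlphaRel (π • t) t := by
  induction t generalizing π with
  | node γ f ts ih =>
  cases γ with
  | free a =>
    rw [smul_node, smul_free, h a (.inl rfl)]
    exact .free _ _ _ _ fun i => ih i π fun b hb => h b (.inr (Set.mem_iUnion_of_mem i hb))
  | nu a =>
    rw [smul_node, smul_nu]
    refine .nu _ _ _ _ _ (⋃ i, (ts i).freeNames)
      (Set.finite_iUnion fun i => freeNames_finite (ts i)) fun c hc i => ?_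
    -- The two swaps send `π • a` through `c` back to `a`, so this permutation fixes every free name
    -- of the child, the bound one included.
    have := (ih i (swp c a * swp c (π • a) * π) ?_).smul (swp c a)
    · simpa only [mul_smul, swp_smul_swp_smul] using this
    · intro b hb
      have hb' : b ∈ ⋃ i, (ts i).freeNames := Set.mem_iUnion_of_mem i hb
      have hbc : b ≠ c := ne_of_mem_of_not_mem hb' hc
      rw [mul_smul, mul_smul]
      by_cases hba : b = a
      · rw [hba, swp_smul_right, swp_smul_left]
      · have hπ : π • b = b := h b ⟨hb', hba⟩
        have hne : b ≠ π • a := fun h' => hba (smul_left_cancel π (hπ.trans h'))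
        rw [hπ, swp_smul_of_ne hbc hne, swp_smul_of_ne hbc hba]

end Terms

/-! ### Runs and supports of rules -/

section Runs
variable {𝔸 : Type u} {F : Type v} {ar : F → ℕ} {Q : Type w}

/-- Successful runs of a tree automaton, by recursion on the term. -/
inductive TreeAut.Run (A : TreeAut 𝔸 ar Q) : Q → Tm 𝔸 ar → Prop
  | node (q : Q) (γ : Bar 𝔸) (f : F) (qs : Fin (ar f) → Q) (ts : Fin (ar f) → Tm 𝔸 ar)
      (h : A.Δ q γ f qs) (hr : ∀ i, A.Run (qs i) (ts i)) : A.Run q (.node γ f ts)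

/-- The extended term can be completed to the given term by successful runs at its states. -/
inductive TreeAut.Completes (A : TreeAut 𝔸 ar Q) : ETm 𝔸 ar Q → Tm 𝔸 ar → Prop
  | st (q : Q) (t : Tm 𝔸 ar) (h : A.Run q t) : A.Completes (.st q t) t
  | node (γ : Bar 𝔸) (f : F) (es : Fin (ar f) → ETm 𝔸 ar Q) (ts : Fin (ar f) → Tm 𝔸 ar)
      (h : ∀ i, A.Completes (es i) (ts i)) : A.Completes (.node γ f es) (.node γ f ts)

theorem TreeAut.completes_toETm (A : TreeAut 𝔸 ar Q) (t : Tm 𝔸 ar) :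
    A.Completes (t.toETm Q) t := by
  induction t with
  | node γ f ts ih => exact .node _ _ _ _ ih

/-- Completability is preserved backwards along steps; since the final term completes to itself, a
rewrite sequence yields a run. -/
theorem TreeAut.Step.completes {A : TreeAut 𝔸 ar Q} {e e' : ETm 𝔸 ar Q} (h : A.Step e e')
    {t : Tm 𝔸 ar} (ht : A.Completes e' t) : A.Completes e t := by
  induction h generalizing t with
  | rule q γ f qs ts h =>
    cases ht with
    | node _ _ _ ts' h' =>
      have : ts' = ts := funext fun i => by
        have := h' i
        generalize ts' i = t' at this
        cases this; rfl
      subst this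
      refine .st _ _ (.node _ _ _ _ _ h fun i => ?_)
      have := h' i
      generalize ts' i = t' at this
      cases this; assumption
  | ctx γ f es i e' h ih =>
    cases ht with
    | node _ _ _ ts' h' =>
      refine .node _ _ _ _ fun j => ?_
      by_cases hj : j = i
      · subst hj
        exact ih (by simpa using h' j)
      · simpa [hj] using h' j

theorem TreeAut.reflTransGen_update (A : TreeAut 𝔸 ar Q) (γ : Bar 𝔸) (f : F)
    (es : Fin (ar f) → ETm 𝔸 ar Q) (i : Fin (ar f)) {e : ETm 𝔸 ar Q}
    (h : Relation.ReflTransGen A.Step (es i) e) :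
    Relation.ReflTransGen A.Step (.node γ f es) (.node γ f (Function.update es i e)) := by
  induction h with
  | refl => rw [Function.update_eq_self]
  | tail _ h ih =>
    refine ih.tail ?_
    have := TreeAut.Step.ctx (A := A) γ f (Function.update es i _) i _ (by simpa using h)
    simpa using this

/-- The children are rewritten one after another; the induction is on the set of those already
finished. -/
theorem TreeAut.reflTransGen_node (A : TreeAut 𝔸 ar Q) (γ : Bar 𝔸) (f : F)
    (es es' : Fin (ar f) → ETm 𝔸 ar Q) (h : ∀ i, Relation.ReflTransGen A.Step (es i) (es' i)) :
    Relation.ReflTransGen A.Step (.node γ f es) (.node γ f es') := by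
  have key : ∀ s : Finset (Fin (ar f)), Relation.ReflTransGen A.Step (.node γ f es)
      (.node γ f fun i => if i ∈ s then es' i else es i) := by
    intro s
    induction s using Finset.induction_on with
    | empty => simpa using Relation.ReflTransGen.refl
    | insert i s hi ih =>
      refine ih.trans ?_
      have := A.reflTransGen_update γ f (fun i => if i ∈ s then es' i else es i) i
        (e := es' i) (by simpa [hi] using h i)
      convert this using 2
      funext j
      by_cases hj : j = i
      · subst hj; simp
      · simp [hj]
  simpa using key Finset.univ

theorem TreeAut.accepts_iff_run (A : TreeAut 𝔸 ar Q) (q : Q) (t : Tm 𝔸 ar) :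
    A.Accepts q t ↔ A.Run q t := by
  constructor
  · intro h
    have key : ∀ e, Relation.ReflTransGen A.Step e (t.toETm Q) → A.Completes e t := by
      intro e h
      induction h using Relation.ReflTransGen.head_induction_on with
      | refl => exact A.completes_toETm t
      | head hs _ ih => exact hs.completes ih
    cases key _ h; assumption
  · intro h
    induction h with
    | node q γ f qs ts h hr ih =>
      exact Relation.ReflTransGen.head (.rule q γ f qs ts h) (A.reflTransGen_node γ f _ _ ih)

theorem TreeAut.mem_lang_iff (A : TreeAut 𝔸 ar Q) (t : Tm 𝔸 ar) :
    t ∈ A.lang ↔ A.Run A.init t :=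
  A.accepts_iff_run _ _

variable [MulAction (FinPerm 𝔸) Q] {A : TreeAut 𝔸 ar Q}

theorem TreeAut.IsRNTA.run_smul (hA : A.IsRNTA) {q : Q} {t : Tm 𝔸 ar} (h : A.Run q t)
    (π : FinPerm 𝔸) : A.Run (π • q) (π • t) := by
  induction h with
  | node q γ f qs ts h hr ih => exact .node _ _ _ _ _ (hA.equivariant π q γ f qs h) ih

theorem TreeAut.IsRNTA.run_inv_smul (hA : A.IsRNTA) {q : Q} {t : Tm 𝔸 ar} {π : FinPerm 𝔸}
    (h : A.Run (π • q) t) : A.Run q (π⁻¹ • t) := by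
  simpa using hA.run_smul h π⁻¹

variable [Infinite 𝔸]

/-- By (ii) and equivariance the possible right-hand sides form a finite set stable under swaps that
fix `q`, so each is supported by `supp q`. -/
theorem TreeAut.IsRNTA.supp_free (hA : A.IsRNTA) {q : Q} {a : 𝔸} {f : F} {qs : Fin (ar f) → Q}
    (h : A.Δ q (.free a) f qs) : a ∈ supp 𝔸 q ∧ ∀ i, supp 𝔸 (qs i) ⊆ supp 𝔸 q := by
  have key := supp_subset_of_finite_of_swp_mem (isNominal_names.prod hA.nominal.pi)
    (hA.finiteFree q f) (hA.nominal.finite_supp q) (z := (a, qs)) (by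
      intro c hc d hd z hz
      have := hA.equivariant (swp c d) q (.free z.1) f z.2 hz
      rwa [swp_smul_eq_of_notMem_supp hc hd] at this) h
  have hsup : MulAction.Supports (FinPerm 𝔸) (supp 𝔸 q) (a, qs) :=
    MulAction.Supports.mono key (supp_supports _)
  constructor
  · by_contra ha
    obtain ⟨d, hd⟩ := exists_notMem_of_finite
      ((hA.nominal.finite_supp q).union (Set.finite_singleton a))
    simp only [Set.mem_union, not_or] at hd
    have := congrArg Prod.fst (swp_smul_eq_of_supports hsup hd.1 ha)
    exact hd.2 (by simpa [eq_comm] using this)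
  · exact fun i => supp_subset_of_supports (hA.nominal.finite_supp q)
      fun π hπ => congrFun (congrArg Prod.snd (hsup π hπ)) i

/-- As for free rules, with the bound name held fixed: abstraction by a fixed `a` is injective, so
only finitely many child tuples occur, and the swaps must also avoid `a`. -/
theorem TreeAut.IsRNTA.supp_nu (hA : A.IsRNTA) {q : Q} {a : 𝔸} {f : F} {qs : Fin (ar f) → Q}
    (h : A.Δ q (.nu a) f qs) (i : Fin (ar f)) : supp 𝔸 (qs i) ⊆ supp 𝔸 q ∪ {a} := by
  have hfin : {qs | A.Δ q (.nu a) f qs}.Finite :=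
    Set.Finite.of_finite_image ((hA.finiteBound q f).subset (by
      rintro _ ⟨qs, hqs, rfl⟩
      exact ⟨a, qs, hqs, rfl⟩)) (absn_injective hA.nominal.pi a).injOn
  refine (supp_apply_subset hA.nominal qs i).trans
    (supp_subset_of_finite_of_swp_mem hA.nominal.pi hfin
      ((hA.nominal.finite_supp q).union (Set.finite_singleton a)) ?_ h)
  intro c hc d hd z hz
  simp only [Set.mem_union, Set.mem_singleton_iff, not_or] at hc hd
  have := hA.equivariant (swp c d) q (.nu a) f z hz
  rwa [swp_smul_eq_of_notMem_supp hc.1 hd.1, smul_nu,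
    swp_smul_of_ne (Ne.symm hc.2) (Ne.symm hd.2)] at this

theorem TreeAut.IsRNTA.freeNames_subset_supp (hA : A.IsRNTA) {q : Q} {t : Tm 𝔸 ar}
    (h : A.Run q t) : t.freeNames ⊆ supp 𝔸 q := by
  induction h with
  | node q γ f qs ts h hr ih =>
  cases γ with
  | free a =>
    obtain ⟨ha, hqs⟩ := hA.supp_free h
    exact Set.union_subset (by simpa using ha)
      (Set.iUnion_subset fun i => (ih i).trans (hqs i))
  | nu a =>
    rintro b ⟨hb, hba⟩
    obtain ⟨i, hi⟩ := Set.mem_iUnion.1 hb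
    exact (hA.supp_nu h i (ih i hi)).resolve_right hba

end Runs

/-! ### Total and partial injective maps -/

section States
variable {𝔸 : Type u} {I : Type v} {X : I → Type w}

/-- The names that occur in a partial injective map. -/
def Partial.names (p : Partial 𝔸 X) : Set 𝔸 := {a | ∃ x, p.2.toFun x = some a}

theorem pInj_restrict_toFun_eq_some {Y : Type w} {r : PInj 𝔸 Y} {N : Set 𝔸} {x : Y} {a : 𝔸} :
    (r.restrict N).toFun x = some a ↔ r.toFun x = some a ∧ a ∈ N := by
  refine Option.filter_eq_some_iff.trans ?_
  simp only [decide_eq_true_eq]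

theorem restrict_toFun_eq_some {q : Strong 𝔸 X} {N : Set 𝔸} {x : X q.1} {a : 𝔸} :
    (q.restrict N).2.toFun x = some a ↔ q.2 x = a ∧ a ∈ N :=
  pInj_restrict_toFun_eq_some.trans (and_congr_left fun _ => Option.some_inj)

theorem pInj_ext {Y : Type w} {r s : PInj 𝔸 Y}
    (h : ∀ x a, r.toFun x = some a ↔ s.toFun x = some a) : r = s :=
  PInj.ext (funext fun x => Option.ext (h x))

theorem pInj_smul_restrict {Y : Type w} (π : FinPerm 𝔸) (r : PInj 𝔸 Y) (N : Set 𝔸) :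
    π • r.restrict N = (π • r).restrict ((π • ·) '' N) := by
  refine pInj_ext fun x a => ?_
  rw [pInj_restrict_toFun_eq_some]
  change ((r.restrict N).toFun x).map (π • ·) = some a ↔ (r.toFun x).map (π • ·) = some a ∧ _
  rw [Option.map_eq_some_iff, Option.map_eq_some_iff]
  simp only [pInj_restrict_toFun_eq_some]
  constructor
  · rintro ⟨b, ⟨hb, hbN⟩, rfl⟩
    exact ⟨⟨b, hb, rfl⟩, b, hbN, rfl⟩
  · rintro ⟨⟨b, hb, rfl⟩, c, hcN, hc⟩
    exact ⟨b, ⟨hb, smul_left_cancel π hc ▸ hcN⟩, rfl⟩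

theorem smul_restrict (π : FinPerm 𝔸) (q : Strong 𝔸 X) (N : Set 𝔸) :
    π • q.restrict N = (π • q).restrict ((π • ·) '' N) :=
  congrArg (Sigma.mk q.1) (pInj_smul_restrict π (PInj.ofEmb q.2) N)

theorem names_supports (p : Partial 𝔸 X) : MulAction.Supports (FinPerm 𝔸) p.names p := by
  obtain ⟨i, r⟩ := p
  refine fun π h => congrArg (Sigma.mk i) (PInj.ext (funext fun x => ?_))
  change (r.toFun x).map (π • ·) = r.toFun x
  rcases hx : r.toFun x with _ | a
  · rfl
  · exact congrArg some (h ⟨x, hx⟩)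

theorem toPartial_injective :
    Function.Injective (Strong.toPartial : Strong 𝔸 X → Partial 𝔸 X) := by
  rintro ⟨i, r⟩ ⟨j, s⟩ h
  obtain ⟨rfl, h⟩ := Sigma.mk.inj h
  refine congrArg (Sigma.mk i) (DFunLike.ext _ _ fun x => ?_)
  exact Option.some.inj (congrArg (fun t => PInj.toFun t x) (eq_of_heq h))

variable [∀ i, Finite (X i)]

theorem isNominal_strong : IsNominal 𝔸 (Strong 𝔸 X) := fun ⟨i, r⟩ =>
  ⟨Set.range r, Set.finite_range r, fun _ h =>
    congrArg (Sigma.mk i) (DFunLike.ext _ _ fun x => h ⟨x, rfl⟩)⟩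

theorem names_finite (p : Partial 𝔸 X) : p.names.Finite :=
  ((Set.finite_range p.2.toFun).preimage (Option.some_injective 𝔸).injOn).subset
    fun _ ⟨x, hx⟩ => ⟨x, hx⟩

theorem isNominal_partial : IsNominal 𝔸 (Partial 𝔸 X) := fun p =>
  ⟨p.names, names_finite p, names_supports p⟩

variable [Infinite 𝔸]

theorem supp_strong (q : Strong 𝔸 X) : supp 𝔸 q = Set.range q.2 := by
  obtain ⟨i, r⟩ := q
  refine supp_eq_of_supports (Set.finite_range r) (fun π h => ?_) ?_
  · exact congrArg (Sigma.mk i) (DFunLike.ext _ _ fun x => h ⟨x, rfl⟩)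
  · rintro _ ⟨x, rfl⟩ d hd h
    have h' : swp d (r x) • r = r := eq_of_heq (Sigma.mk.inj h).2
    have h'' : swp d (r x) • r x = r x := DFunLike.congr_fun h' x
    rw [swp_smul_right] at h''
    exact hd ⟨x, h''.symm⟩

theorem supp_partial (p : Partial 𝔸 X) : supp 𝔸 p = p.names := by
  refine supp_eq_of_supports (names_finite p) (names_supports p) ?_
  obtain ⟨i, r⟩ := p
  rintro a ⟨x, hx⟩ d hd h
  have h' : swp d a • r = r := eq_of_heq (Sigma.mk.inj h).2
  have h'' : (r.toFun x).map (swp d a • ·) = r.toFun x := congrArg (fun s => s.toFun x) h'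
  refine hd ⟨x, ?_⟩
  rw [← h'', hx, Option.map_some, swp_smul_right]

theorem supp_restrict {q : Strong 𝔸 X} {N : Set 𝔸} (hN : N ⊆ supp 𝔸 q) :
    supp 𝔸 (q.restrict N) = N := by
  rw [supp_partial]
  ext a
  constructor
  · rintro ⟨x, hx⟩
    exact (restrict_toFun_eq_some.1 hx).2
  · intro ha
    rw [supp_strong] at hN
    obtain ⟨x, hx⟩ := hN ha
    exact ⟨x, restrict_toFun_eq_some.2 ⟨hx, ha⟩⟩

theorem restrict_supports {q : Strong 𝔸 X} {N : Set 𝔸} (hN : N ⊆ supp 𝔸 q) :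
    MulAction.Supports (FinPerm 𝔸) N (q.restrict N) := by
  have := supp_supports (𝔸 := 𝔸) (q.restrict N)
  rwa [supp_restrict hN] at this

theorem toPartial_eq_restrict (q : Strong 𝔸 X) : q.toPartial = q.restrict (supp 𝔸 q) := by
  refine congrArg (Sigma.mk q.1) (pInj_ext fun x a => ?_)
  change some (q.2 x) = some a ↔ (q.restrict (supp 𝔸 q)).2.toFun x = some a
  rw [restrict_toFun_eq_some, supp_strong, Option.some_inj]
  exact ⟨fun h => ⟨h, x, h⟩, fun h => h.1⟩

theorem supp_toPartial (q : Strong 𝔸 X) : supp 𝔸 q.toPartial = supp 𝔸 q := by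
  rw [toPartial_eq_restrict, supp_restrict subset_rfl]

/-- Every partial injective map is the restriction of a total one. -/
theorem exists_restrict_eq (p : Partial 𝔸 X) :
    ∃ q : Strong 𝔸 X, p.names ⊆ supp 𝔸 q ∧ q.restrict p.names = p := by
  have hinf : Infinite ↥(p.names)ᶜ := (names_finite p).infinite_compl.to_subtype
  obtain ⟨n, ⟨e⟩⟩ := Finite.exists_equiv_fin (X p.1)
  -- Undefined positions are filled with distinct names that do not occur in `p`.
  let g : X p.1 ↪ ↥(p.names)ᶜ :=
    e.toEmbedding.trans (Fin.valEmbedding.trans (Infinite.natEmbedding _))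
  have hg : ∀ x y, p.2.toFun x ≠ some (g y : 𝔸) := fun x y h => (g y).2 ⟨x, h⟩
  let r : X p.1 ↪ 𝔸 :=
    { toFun := fun x => (p.2.toFun x).getD (g x)
      inj' := by
        intro x y h
        simp only at h
        rcases hx : p.2.toFun x with _ | a <;> rcases hy : p.2.toFun y with _ | b <;>
          simp only [hx, hy, Option.getD_none, Option.getD_some] at h
        · exact g.injective (Subtype.ext h)
        · exact absurd (h ▸ hy) (hg y x)
        · exact absurd (h ▸ hx) (hg x y)
        · exact p.2.inj x y a hx (h ▸ hy) }
  have hr : ∀ x a, p.2.toFun x = some a → r x = a := fun x a h => by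
    change (p.2.toFun x).getD (g x) = a
    rw [h, Option.getD_some]
  refine ⟨⟨p.1, r⟩, ?_, congrArg (Sigma.mk p.1) (pInj_ext fun x a => ?_)⟩
  · rw [supp_strong]
    rintro a ⟨x, hx⟩
    exact ⟨x, hr x a hx⟩
  · refine restrict_toFun_eq_some.trans ⟨?_, fun h => ⟨hr x a h, x, h⟩⟩
    rintro ⟨h, y, hy⟩
    have hxy : x = y := r.injective (h.trans (hr y a hy).symm)
    rwa [hxy]

/-- A partial map may be written as `q|_N` in several ways: `N` is its support, and `q` is unique up
to permutations fixing `N`. This allows passing to the presentation that a rule of `A_⊥` happens to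
use. -/
theorem exists_smul_eq_of_restrict_eq {q q' : Strong 𝔸 X} {N N' : Set 𝔸} (hN : N ⊆ supp 𝔸 q)
    (hN' : N' ⊆ supp 𝔸 q') (h : q.restrict N = q'.restrict N') :
    N = N' ∧ ∃ π : FinPerm 𝔸, π • q = q' ∧ ∀ a ∈ N, π • a = a := by
  have hNN : N = N' := by rw [← supp_restrict hN, h, supp_restrict hN']
  subst hNN
  refine ⟨rfl, ?_⟩
  obtain ⟨i, r⟩ := q
  obtain ⟨j, s⟩ := q'
  obtain rfl : i = j := congrArg Sigma.fst h
  obtain ⟨π, hπ⟩ := exists_smul_eq_of_injective r.injective s.injective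
  refine ⟨π, congrArg (Sigma.mk i) (DFunLike.ext _ _ hπ), fun a ha => ?_⟩
  rw [supp_strong] at hN
  obtain ⟨x, rfl⟩ := hN ha
  refine (hπ x).trans ?_
  have h' := congrArg (fun t => PInj.toFun t x) (eq_of_heq (Sigma.mk.inj h).2)
  exact (restrict_toFun_eq_some (q := ⟨i, s⟩).1
    (h'.symm.trans (restrict_toFun_eq_some (q := ⟨i, r⟩).2 ⟨rfl, ha⟩))).1

theorem finite_supp_subset_partial [Finite I] {S : Set 𝔸} (hS : S.Finite) :
    {p : Partial 𝔸 X | supp 𝔸 p ⊆ S}.Finite := by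
  have key : ∀ i, {r : PInj 𝔸 (X i) | ∀ x, r.toFun x ∈ insert none (some '' S)}.Finite := by
    intro i
    refine Set.Finite.of_finite_image (f := PInj.toFun) ?_ (fun r _ s _ h => PInj.ext h)
    refine (Set.Finite.pi' (t := fun _ : X i => insert none (some '' S))
      fun _ => (hS.image some).insert none).subset ?_
    rintro _ ⟨r, hr, rfl⟩
    exact hr
  refine (Set.finite_iUnion fun i => (key i).image (Sigma.mk i)).subset ?_
  rintro ⟨i, r⟩ h
  refine Set.mem_iUnion.2 ⟨i, r, fun x => ?_, rfl⟩
  rw [Set.mem_ofPred_eq, supp_partial] at h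
  rcases hx : r.toFun x with _ | a
  · exact .inl rfl
  · exact .inr ⟨a, h ⟨x, hx⟩, rfl⟩

theorem finite_supp_subset_strong [Finite I] {S : Set 𝔸} (hS : S.Finite) :
    {q : Strong 𝔸 X | supp 𝔸 q ⊆ S}.Finite :=
  Set.Finite.of_finite_image ((finite_supp_subset_partial hS).subset (by
    rintro _ ⟨q, hq, rfl⟩
    exact (supp_toPartial q).trans_subset hq)) toPartial_injective.injOn

end States

/-! ### Orbits and degree -/

section Orbits
variable {𝔸 : Type u} {I : Type v} {X : I → Type w} [∀ i, Finite (X i)]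

theorem exists_smul_eq_strong (e : ∀ i, X i ↪ 𝔸) (q : Strong 𝔸 X) :
    ∃ π : FinPerm 𝔸, π • (⟨q.1, e q.1⟩ : Strong 𝔸 X) = q := by
  obtain ⟨i, r⟩ := q
  obtain ⟨π, hπ⟩ := exists_smul_eq_of_injective (e i).injective r.injective
  exact ⟨π, congrArg (Sigma.mk i) (DFunLike.ext _ _ hπ)⟩

variable [Infinite 𝔸]

theorem nonempty_embedding_names (Y : Type w) [Finite Y] : Nonempty (Y ↪ 𝔸) := by
  obtain ⟨n, ⟨e⟩⟩ := Finite.exists_equiv_fin Y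
  exact ⟨e.toEmbedding.trans (Fin.valEmbedding.trans (Infinite.natEmbedding 𝔸))⟩

theorem finite_orbits_strong [Finite I] : Finite (Orbits 𝔸 (Strong 𝔸 X)) := by
  have e := fun i => Classical.choice (nonempty_embedding_names (𝔸 := 𝔸) (X i))
  refine Finite.of_surjective
    (fun i : I => (Quotient.mk _ (⟨i, e i⟩ : Strong 𝔸 X) : Orbits 𝔸 (Strong 𝔸 X))) ?_
  rintro ⟨q⟩
  obtain ⟨π, hπ⟩ := exists_smul_eq_strong e q
  exact ⟨q.1, (Quotient.sound (s := MulAction.orbitRel (FinPerm 𝔸) (Strong 𝔸 X)) ⟨π, hπ⟩).symm⟩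

/-- The index of an orbit. -/
def orbitIndex (𝔸 : Type u) {I : Type v} (X : I → Type w) : Orbits 𝔸 (Strong 𝔸 X) → I :=
  Quotient.lift Sigma.fst (by
    rintro _ q ⟨π, rfl⟩
    rfl)

theorem orbitIndex_surjective : Function.Surjective (orbitIndex 𝔸 X) := fun i =>
  (nonempty_embedding_names (X i)).elim fun r => ⟨Quotient.mk _ ⟨i, r⟩, rfl⟩

/-- After extending to a total map and moving that to the fixed embedding `e i`, only the index and
the domain remain, so the orbits number at most `∑ i, 2 ^ |X i|`. -/
theorem orbits_partial [Finite I] {d : ℕ} (hd : ∀ i, Nat.card (X i) ≤ d) :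
    Finite (Orbits 𝔸 (Partial 𝔸 X)) ∧
      Nat.card (Orbits 𝔸 (Partial 𝔸 X)) ≤ 2 ^ d * Nat.card I := by
  have e := fun i => Classical.choice (nonempty_embedding_names (𝔸 := 𝔸) (X i))
  let g : (Σ i, Set (X i)) → Orbits 𝔸 (Partial 𝔸 X) := fun z =>
    Quotient.mk _ (Strong.restrict ⟨z.1, e z.1⟩ (e z.1 '' z.2))
  have hg : g.Surjective := by
    rintro ⟨p⟩
    obtain ⟨q, hN, hq⟩ := exists_restrict_eq p
    obtain ⟨i, r⟩ := q
    obtain ⟨π, rfl⟩ : ∃ π : FinPerm 𝔸, π • e i = r := by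
      obtain ⟨π, hπ⟩ := exists_smul_eq_of_injective (e i).injective r.injective
      exact ⟨π, DFunLike.ext _ _ hπ⟩
    have hsub : (π⁻¹ • ·) '' p.names ⊆ Set.range (e i) := by
      rintro _ ⟨a, ha, rfl⟩
      rw [supp_strong] at hN
      obtain ⟨x, rfl⟩ := hN ha
      exact ⟨x, (inv_smul_smul π (e i x)).symm⟩
    refine ⟨⟨i, e i ⁻¹' ((π⁻¹ • ·) '' p.names)⟩, ?_⟩
    refine (Quotient.sound (s := MulAction.orbitRel (FinPerm 𝔸) (Partial 𝔸 X)) ⟨π, ?_⟩).symm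
    simp only
    rw [Set.image_preimage_eq_of_subset hsub, smul_restrict, Set.image_image]
    simpa using hq
  refine ⟨Finite.of_surjective g hg, (Nat.card_le_card_of_surjective g hg).trans ?_⟩
  have := Fintype.ofFinite I
  have := fun i => Fintype.ofFinite (X i)
  rw [Nat.card_sigma, Nat.card_eq_fintype_card, mul_comm]
  refine Finset.sum_le_card_nsmul _ _ _ fun i _ => ?_
  rw [Nat.card_eq_fintype_card, Fintype.card_set, ← Nat.card_eq_fintype_card]
  exact Nat.pow_le_pow_right two_pos (hd i)

theorem encard_supp_strong (q : Strong 𝔸 X) : (supp 𝔸 q).encard = Nat.card (X q.1) := by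
  rw [supp_strong, ← Set.image_univ, q.2.injective.encard_image, Set.encard_univ,
    ENat.card_eq_coe_natCard]

theorem card_le_of_hasDegree {d : ℕ} (h : HasDegree 𝔸 (Strong 𝔸 X) d) (i : I) :
    Nat.card (X i) ≤ d := by
  obtain ⟨r⟩ := nonempty_embedding_names (𝔸 := 𝔸) (X i)
  have := h.2 ⟨⟨i, r⟩, rfl⟩
  simp only [encard_supp_strong] at this
  exact_mod_cast this

theorem HasDegree.partial {d : ℕ} (h : HasDegree 𝔸 (Strong 𝔸 X) d) :
    HasDegree 𝔸 (Partial 𝔸 X) d := by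
  constructor
  · obtain ⟨q, hq⟩ := h.1
    exact ⟨q.toPartial, by simpa only [supp_toPartial] using hq⟩
  · rintro _ ⟨p, rfl⟩
    obtain ⟨q, hN, hq⟩ := exists_restrict_eq p
    simp only [supp_partial]
    exact (Set.encard_le_encard hN).trans (h.2 ⟨q, rfl⟩)

theorem exists_hasDegree_strong [Finite I] [Nonempty I] : ∃ d, HasDegree 𝔸 (Strong 𝔸 X) d := by
  obtain ⟨i, hi⟩ := Finite.exists_max fun i => Nat.card (X i)
  obtain ⟨r⟩ := nonempty_embedding_names (𝔸 := 𝔸) (X i)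
  refine ⟨Nat.card (X i), ⟨⟨i, r⟩, encard_supp_strong _⟩, ?_⟩
  rintro _ ⟨q, rfl⟩
  simp only [encard_supp_strong]
  exact_mod_cast hi q.1

end Orbits

/-! ### The name-dropping modification -/

section NameDropping
variable {𝔸 : Type u} [Infinite 𝔸] {I : Type v} {X : I → Type w} [∀ i, Finite (X i)]
  {F : Type*} {ar : F → ℕ} {A : TreeAut 𝔸 ar (Strong 𝔸 X)}

theorem NameDropRule.smul (hA : A.IsRNTA) {p : Partial 𝔸 X} {γ : Bar 𝔸} {f : F}
    {ps : Fin (ar f) → Partial 𝔸 X} (h : NameDropRule A p γ f ps) (π : FinPerm 𝔸) :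
    NameDropRule A (π • p) (π • γ) f (π • ps) := by
  cases h with
  | free _ q q' N Ns a hN hNs ha h =>
    have := NameDropRule.free f (π • q) (π • q') ((π • ·) '' N) (fun i => (π • ·) '' Ns i) (π • a)
      (image_subset_supp_smul hN π) (fun i => ?_) ⟨a, ha, rfl⟩
      (hA.equivariant π q (.free a) f q' h)
    · rw [smul_restrict, smul_free]
      convert this using 1
      exact funext fun i => smul_restrict π _ _
    · exact Set.subset_inter (image_subset_supp_smul ((hNs i).trans Set.inter_subset_left) π)
        (Set.image_mono ((hNs i).trans Set.inter_subset_right))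
  | bound _ q q' N Ns a b q'' hN hNs h hq =>
    rw [smul_restrict, smul_nu]
    refine NameDropRule.bound f (π • q) (π • q') ((π • ·) '' N) (fun i => (π • ·) '' Ns i) (π • a)
      (π • b) (π • ps) (image_subset_supp_smul hN π) (fun i => ?_)
      (hA.equivariant π q (.nu a) f q' h) fun i => ?_
    · refine Set.subset_inter (image_subset_supp_smul ((hNs i).trans Set.inter_subset_left) π) ?_
      rw [← Set.image_singleton (f := (π • ·)), ← Set.image_union]
      exact Set.image_mono ((hNs i).trans Set.inter_subset_right)
    · rw [Pi.smul_apply, Pi.smul_apply, ← smul_restrict]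
      obtain ⟨S, hS, h⟩ := (absn_eq_iff isNominal_partial).1 (hq i)
      refine (absn_eq_iff isNominal_partial).2 ⟨(π • ·) '' S, hS.image _, fun c hc => ?_⟩
      have := congrArg (π • ·) (h (π⁻¹ • c) fun h => hc ⟨_, h, smul_inv_smul π c⟩)
      simpa only [smul_swp_smul, smul_inv_smul] using this

/-- α-invariance is built into the bound rules, which allow any representative of the child
abstractions. Finiteness holds as the children are supported by `N`, respectively `N ∪ {a}`. -/
theorem nameDrop_isRNTA [Finite I] (hA : A.IsRNTA) : A.nameDrop.IsRNTA where
  nominal := isNominal_partial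
  orbitFinite := by
    have : Nonempty I := ⟨A.init.1⟩
    obtain ⟨d, hd⟩ := exists_hasDegree_strong (𝔸 := 𝔸) (X := X)
    exact (orbits_partial (card_le_of_hasDegree hd)).1
  equivariant π q γ f qs h := NameDropRule.smul hA h π
  alphaInvariant q a b f qs qs' hab h := by
    change NameDropRule A _ _ _ _ at h
    change NameDropRule A _ _ _ _
    cases h with
    | bound _ q q' N Ns a' b' q'' hN hNs h hq =>
      exact .bound f q q' N Ns a' b qs' hN hNs h fun i =>
        (hq i).trans (absn_apply isNominal_partial hab i)
  finiteFree q f := by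
    have hS := (isNominal_partial (𝔸 := 𝔸) (X := X)).finite_supp q
    refine (hS.prod (Set.Finite.pi' (ι := Fin (ar f)) fun _ =>
      finite_supp_subset_partial hS)).subset ?_
    rintro ⟨a, qs⟩ (h : NameDropRule A _ _ _ _)
    simp only at h
    cases h with
    | free _ q q' N Ns a hN hNs ha h =>
      rw [supp_restrict hN]
      refine ⟨ha, fun i => ?_⟩
      rw [Set.mem_ofPred_eq]
      rw [supp_restrict ((hNs i).trans Set.inter_subset_left)]
      exact (hNs i).trans Set.inter_subset_right
  finiteBound q f := by
    have hS := (isNominal_partial (𝔸 := 𝔸) (X := X)).finite_supp q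
    refine (finite_absn (ι := Fin (ar f)) isNominal_partial
      (fun S hS => finite_supp_subset_partial hS) hS).subset ?_
    rintro z ⟨b, qs, (h : NameDropRule A _ _ _ _), rfl⟩
    cases h with
    | bound _ q q' N Ns a b q'' hN hNs h hq =>
      refine ⟨a, fun i => (q' i).restrict (Ns i), fun i => ?_, absn_funext isNominal_partial hq⟩
      rw [supp_restrict hN, supp_restrict ((hNs i).trans Set.inter_subset_left)]
      exact (hNs i).trans Set.inter_subset_right

/-- Terms accepted by `q|_N` in the name-dropping modification are α-equivalent to terms
accepted by `q`, and their free names lie in `N`. -/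
theorem exists_run_of_run_nameDrop (hA : A.IsRNTA) {p : Partial 𝔸 X} {t : Tm 𝔸 ar}
    (h : A.nameDrop.Run p t) (q : Strong 𝔸 X) (N : Set 𝔸) (hN : N ⊆ supp 𝔸 q)
    (hp : q.restrict N = p) : t.freeNames ⊆ N ∧ ∃ s, A.Run q s ∧ AlphaRel s t := by
  induction h generalizing q N with
  | node p γ f ps ts h hr ih =>
  change NameDropRule A _ _ _ _ at h
  -- One presentation of `p` suffices: passing to another applies a permutation fixing `N₀`, which
  -- replaces `s` by an α-equivalent term since its free names lie in `N₀`.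
  suffices H : ∃ (q₀ : Strong 𝔸 X) (N₀ : Set 𝔸), N₀ ⊆ supp 𝔸 q₀ ∧ q₀.restrict N₀ = p ∧
      (Tm.node γ f ts).freeNames ⊆ N₀ ∧ ∃ s, A.Run q₀ s ∧ AlphaRel s (.node γ f ts) by
    obtain ⟨q₀, N₀, hN₀, hp₀, hfn, s, hs, hst⟩ := H
    obtain ⟨rfl, π, rfl, hπ⟩ := exists_smul_eq_of_restrict_eq hN₀ hN (hp₀.trans hp.symm)
    refine ⟨hfn, π • s, hA.run_smul hs π, (alphaRel_smul_self s π fun a ha => ?_).trans hst⟩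
    rw [hst.freeNames_eq] at ha
    exact hπ a (hfn ha)
  clear hN hp q N
  cases h with
  | free _ q q' N Ns a hN hNs ha h =>
    have := fun i => ih i (q' i) (Ns i) ((hNs i).trans Set.inter_subset_left) rfl
    choose hfn s hs hst using this
    exact ⟨q, N, hN, rfl, Set.union_subset (by simpa using ha) (Set.iUnion_subset fun i =>
      (hfn i).trans ((hNs i).trans Set.inter_subset_right)), .node (.free a) f s,
      .node _ _ _ _ _ h hs, .free _ _ _ _ hst⟩
  | bound _ q q' N Ns a b _ hN hNs h hq =>
    obtain ⟨S, hS, hqS⟩ := (absn_eq_iff isNominal_partial.pi).1 (absn_funext isNominal_partial hq)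
    have hNf : N.Finite := (isNominal_strong.finite_supp q).subset hN
    obtain ⟨c, hc⟩ := exists_notMem_of_finite (hS.union (hNf.union
      (Set.finite_iUnion fun i => isNominal_partial.finite_supp (ps i))))
    simp only [Set.mem_union, Set.mem_iUnion, not_or, not_exists] at hc
    obtain ⟨hcS, hcN, hcp⟩ := hc
    -- Renaming `a` to `b` through the fresh `c` carries the restricted children of the rule of `A`
    -- to the given `ps i`.
    have hps : ∀ i, ((swp c b * swp c a) • q' i).restrict
        ((fun x : 𝔸 => (swp c b * swp c a) • x) '' Ns i) = ps i := by
      intro i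
      have : swp c a • (q' i).restrict (Ns i) = swp c b • ps i := congrFun (hqS c hcS) i
      rw [← smul_restrict, mul_smul, this, swp_smul_swp_smul]
    have hsub : ∀ i, (fun x : 𝔸 => (swp c b * swp c a) • x) '' Ns i ⊆
        supp 𝔸 ((swp c b * swp c a) • q' i) := fun i =>
      image_subset_supp_smul ((hNs i).trans Set.inter_subset_left) _
    have hNsN : ∀ i, Ns i ⊆ N ∪ {a} := fun i => (hNs i).trans Set.inter_subset_right
    have hρ : ∀ i, ∀ x ∈ Ns i, x ≠ a → x ∈ N ∧ x ≠ b ∧ (swp c b * swp c a) • x = x := by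
      intro i x hx hxa
      have hxN : x ∈ N := (hNsN i hx).resolve_right hxa
      have hxc : x ≠ c := ne_of_mem_of_not_mem hxN hcN
      -- If `b ≠ a` had survived in `Ns i`, the renaming would send it to `c`, which is fresh for
      -- `ps i`.
      have hxb : x ≠ b := by
        rintro rfl
        refine hcp i ?_
        rw [← hps i, supp_restrict (hsub i)]
        refine ⟨x, hx, ?_⟩
        change (swp c x * swp c a) • x = c
        rw [mul_smul, swp_smul_of_ne hxc hxa, swp_smul_right]
      exact ⟨hxN, hxb, by rw [mul_smul, swp_smul_of_ne hxc hxa, swp_smul_of_ne hxc hxb]⟩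
    have hρa : (swp c b * swp c a) • a = b := by rw [mul_smul, swp_smul_right, swp_smul_left]
    have := fun i => ih i _ _ (hsub i) (hps i)
    choose hfn s hs hst using this
    -- Undoing the renaming on the child terms makes the original rule, with bound name `a`,
    -- applicable.
    refine ⟨q, N, hN, rfl, ?_, .node (.nu a) f fun i => (swp c b * swp c a)⁻¹ • s i, ?_, ?_⟩
    · rintro x ⟨hx, hxb⟩
      obtain ⟨i, hi⟩ := Set.mem_iUnion.1 hx
      obtain ⟨y, hy, rfl⟩ := hfn i hi
      simp only at hxb ⊢
      by_cases hya : y = a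
      · rw [hya] at hxb
        exact absurd hρa hxb
      · rw [(hρ i y hy hya).2.2]
        exact (hρ i y hy hya).1
    · refine .node _ _ _ _ _ h fun i => ?_
      exact hA.run_inv_smul (hs i)
    · refine .nu _ _ _ _ _ N hNf fun d hd i => ?_
      refine (((hst i).smul _).smul _).trans ?_
      refine (AlphaRel.of_smul (π := swp d b) ?_)
      rw [swp_smul_swp_smul, ← mul_smul, ← mul_smul]
      refine alphaRel_smul_self _ _ fun x hx => ?_
      obtain ⟨y, hy, rfl⟩ := hfn i hx
      simp only
      rw [mul_smul, mul_smul, inv_smul_smul]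
      by_cases hya : y = a
      · rw [hya, hρa, swp_smul_right, swp_smul_left]
      · obtain ⟨hyN, hyb, hy'⟩ := hρ i y hy hya
        have hyd : y ≠ d := ne_of_mem_of_not_mem hyN hd
        rw [hy', swp_smul_of_ne hyd hya, swp_smul_of_ne hyd hyb]

/-- Terms α-equivalent to a term accepted by `q` are accepted by `q|_N` in the name-dropping
modification, as soon as `N` contains their free names. -/
theorem run_nameDrop_of_alphaRel (hA : A.IsRNTA) {q : Strong 𝔸 X} {s t : Tm 𝔸 ar}
    (hst : AlphaRel s t) (hs : A.Run q s) {N : Set 𝔸} (hN : N ⊆ supp 𝔸 q)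
    (ht : t.freeNames ⊆ N) : A.nameDrop.Run (q.restrict N) t := by
  induction t generalizing q s N with
  | node γ f ts ih =>
  cases hst with
  | free a _ ss _ hst =>
    cases hs with
    | node _ _ _ q' _ h hr =>
      have hfn : ∀ i, (ts i).freeNames ⊆ supp 𝔸 (q' i) := fun i => by
        rw [← (hst i).freeNames_eq]
        exact hA.freeNames_subset_supp (hr i)
      have htN : ∀ i, (ts i).freeNames ⊆ N := fun i =>
        ((Set.subset_iUnion (fun i => (ts i).freeNames) i).trans Set.subset_union_right).trans ht
      -- Each child keeps exactly the free names of its subterm.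
      exact .node _ _ _ _ _ (NameDropRule.free f q q' N (fun i => (ts i).freeNames) a hN
        (fun i => Set.subset_inter (hfn i) (htN i)) (ht (.inl rfl)) h)
        fun i => ih i (hst i) (hr i) (hfn i) subset_rfl
  | nu a b _ ss _ S hS hst =>
    cases hs with
    | node _ _ _ q' _ h hr =>
      have hfn : ∀ i, (ss i).freeNames ⊆ supp 𝔸 (q' i) := fun i =>
        hA.freeNames_subset_supp (hr i)
      have hfeq : (Tm.node (.nu a) f ss).freeNames = (Tm.node (.nu b) f ts).freeNames :=
        (AlphaRel.nu a b f ss ts S hS hst).freeNames_eq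
      have hsN : ∀ i, (ss i).freeNames ⊆ N ∪ {a} := fun i x hx => by
        by_cases hxa : x = a
        · exact .inr hxa
        · exact .inl (ht (hfeq ▸ ⟨Set.mem_iUnion_of_mem i hx, hxa⟩))
      have hbs : ∀ i, b ∈ (ss i).freeNames → b = a := by
        intro i hb
        by_contra hba
        have : b ∈ (Tm.node (.nu b) f ts).freeNames := hfeq ▸ ⟨Set.mem_iUnion_of_mem i hb, hba⟩
        exact this.2 rfl
      obtain ⟨c, hc⟩ := exists_notMem_of_finite
        (hS.union (Set.finite_iUnion fun i => freeNames_finite (ss i)))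
      simp only [Set.mem_union, Set.mem_iUnion, not_or, not_exists] at hc
      obtain ⟨hcS, hcs⟩ := hc
      -- As `b` is not free in `ss i` unless it equals `a`, the detour through `c` shortens to the
      -- direct swap of `a` and `b`.
      have hst' : ∀ i, AlphaRel (swp b a • ss i) (ts i) := by
        intro i
        refine AlphaRel.of_smul (π := swp c b) (AlphaRel.trans ?_ (hst c hcS i))
        refine AlphaRel.of_smul (π := swp c a) ?_
        rw [swp_smul_swp_smul, ← mul_smul, ← mul_smul]
        refine alphaRel_smul_self _ _ fun x hx => ?_
        rw [mul_smul, mul_smul]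
        by_cases hxa : x = a
        · rw [hxa, swp_smul_right, swp_smul_right, swp_smul_left]
        · have hxc : x ≠ c := ne_of_mem_of_not_mem hx (hcs i)
          have hxb : x ≠ b := fun h => hxa (h.trans (hbs i (h ▸ hx)))
          rw [swp_smul_of_ne hxb hxa, swp_smul_of_ne hxc hxb, swp_smul_of_ne hxc hxa]
      -- The name `b` may lie in the support of `q' i`; dropping the names not free in `ss i`
      -- removes it, which makes the renaming legal.
      refine .node _ _ _ _ _ (NameDropRule.bound f q q' N (fun i => (ss i).freeNames) a b
        (fun i => swp b a • (q' i).restrict (ss i).freeNames) hN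
        (fun i => Set.subset_inter (hfn i) (hsN i)) h fun i => ?_) fun i => ?_
      · exact absn_swp_smul isNominal_partial (freeNames_finite (ss i))
          (restrict_supports (hfn i)) (hbs i)
      · rw [smul_restrict]
        refine ih i (hst' i) (hA.run_smul (hr i) _) ?_ ?_
        · exact image_subset_supp_smul (hfn i) _
        · rw [← freeNames_smul, (hst' i).freeNames_eq]

end NameDropping

/-! ### Literal and alphatic languages -/

section Languages
variable {𝔸 : Type u} {F : Type*} {ar : F → ℕ}

theorem image_alphaClosure (L : Set (Tm 𝔸 ar)) :
    Quotient.mk (alphaSetoid 𝔸 ar) '' alphaClosure L = Quotient.mk (alphaSetoid 𝔸 ar) '' L := by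
  ext z
  constructor
  · rintro ⟨t, ⟨s, hs, hst⟩, rfl⟩
    exact ⟨s, hs, Quotient.sound (s := alphaSetoid 𝔸 ar) hst⟩
  · rintro ⟨t, ht, rfl⟩
    exact ⟨t, ⟨t, ht, .refl t⟩, rfl⟩

variable [Infinite 𝔸] {I : Type v} {X : I → Type w} [∀ i, Finite (X i)]
  {A : TreeAut 𝔸 ar (Strong 𝔸 X)}

theorem nameDrop_lang (hA : A.IsRNTA) : A.nameDrop.lang = alphaClosure A.lang := by
  ext t
  rw [TreeAut.mem_lang_iff]
  constructor
  · intro h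
    obtain ⟨-, s, hs, hst⟩ := exists_run_of_run_nameDrop hA h A.init (supp 𝔸 A.init) subset_rfl
      (toPartial_eq_restrict _).symm
    exact ⟨s, (A.mem_lang_iff s).2 hs, hst.alphaEq⟩
  · rintro ⟨s, hs, hst⟩
    rw [TreeAut.mem_lang_iff] at hs
    change A.nameDrop.Run A.init.toPartial t
    rw [toPartial_eq_restrict]
    exact run_nameDrop_of_alphaRel hA hst.alphaRel hs subset_rfl
      (hst.alphaRel.freeNames_eq ▸ hA.freeNames_subset_supp hs)

theorem nameDrop_alphaLang (hA : A.IsRNTA) : A.nameDrop.alphaLang = A.alphaLang := by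
  rw [TreeAut.alphaLang, nameDrop_lang hA, image_alphaClosure, TreeAut.alphaLang]

end Languages

/-! ### Reduction to strong nominal state sets -/

section Pullback
variable {𝔸 : Type u} {F : Type*} {ar : F → ℕ} {Q : Type v} {Q' : Type w}

/-- The automaton with states `Q'` whose rules are those mapped to rules of `A` by `h`. -/
def TreeAut.pullback (A : TreeAut 𝔸 ar Q) (h : Q' → Q) (q₀ : Q') : TreeAut 𝔸 ar Q' where
  Δ q γ f qs := A.Δ (h q) γ f (fun i => h (qs i))
  init := q₀

theorem TreeAut.run_pullback (A : TreeAut 𝔸 ar Q) {h : Q' → Q} (hh : h.Surjective) (q₀ q : Q')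
    (t : Tm 𝔸 ar) : (A.pullback h q₀).Run q t ↔ A.Run (h q) t := by
  constructor
  · intro H
    induction H with
    | node q γ f qs ts hr _ ih => exact .node _ _ _ _ _ hr ih
  · intro H
    generalize hp : h q = p at H
    induction H generalizing q with
    | node p γ f ps ts hr _ ih =>
      choose qs hqs using fun i => hh (ps i)
      refine .node _ _ _ qs _ ?_ fun i => ih i (qs i) (hqs i)
      change A.Δ (h q) γ f fun i => h (qs i)
      rwa [hp, funext hqs]

theorem TreeAut.pullback_lang (A : TreeAut 𝔸 ar Q) {h : Q' → Q} (hh : h.Surjective) {q₀ : Q'}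
    (hq₀ : h q₀ = A.init) : (A.pullback h q₀).lang = A.lang := by
  ext t
  rw [TreeAut.mem_lang_iff, TreeAut.mem_lang_iff, A.run_pullback hh, ← hq₀]
  rfl

variable [MulAction (FinPerm 𝔸) Q] [MulAction (FinPerm 𝔸) Q']

theorem hasDegree_of_surjective {h : Q' → Q} (hh : h.Surjective)
    (hsupp : ∀ q, supp 𝔸 (h q) = supp 𝔸 q) {d : ℕ} (hd : HasDegree 𝔸 Q' d) :
    HasDegree 𝔸 Q d := by
  have : Set.range (fun q : Q => (supp 𝔸 q).encard) =
      Set.range fun q : Q' => (supp 𝔸 q).encard := by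
    rw [← hh.range_comp]
    exact congrArg Set.range (funext fun q => by simp only [Function.comp_apply, hsupp])
  rwa [HasDegree, this]

variable [Infinite 𝔸]

/-- As `h` preserves supports, the bounds on the children in `A` hold upstairs too, where `hfin`
turns them into finiteness. -/
theorem TreeAut.IsRNTA.pullback {A : TreeAut 𝔸 ar Q} (hA : A.IsRNTA) {h : Q' → Q} (q₀ : Q')
    (hnom : IsNominal 𝔸 Q') [Finite (Orbits 𝔸 Q')]
    (hfin : ∀ S : Set 𝔸, S.Finite → {q : Q' | supp 𝔸 q ⊆ S}.Finite)
    (hsmul : ∀ (π : FinPerm 𝔸) q, h (π • q) = π • h q)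
    (hsupp : ∀ q, supp 𝔸 (h q) = supp 𝔸 q) : (A.pullback h q₀).IsRNTA where
  nominal := hnom
  orbitFinite := inferInstance
  equivariant π q γ f qs H := by
    have := hA.equivariant π _ _ _ _ H
    change A.Δ (h (π • q)) (π • γ) f fun i => h (π • qs i)
    simp only [hsmul]
    exact this
  alphaInvariant q a b f qs qs' hab H :=
    hA.alphaInvariant _ a b f _ _ (absn_map hnom.pi hA.nominal.pi (fun qs i => h (qs i))
      (fun π qs => funext fun i => hsmul π (qs i)) hab) H
  finiteFree q f := by
    have hS := hA.nominal.finite_supp (h q)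
    refine (hS.prod (Set.Finite.pi' (ι := Fin (ar f)) fun _ => hfin _ hS)).subset ?_
    rintro ⟨a, qs⟩ (H : A.Δ (h q) (.free a) f fun i => h (qs i))
    obtain ⟨ha, hqs⟩ := hA.supp_free H
    exact ⟨ha, fun i => (hsupp (qs i)).symm.trans_subset (hqs i)⟩
  finiteBound q f := by
    refine (finite_absn (ι := Fin (ar f)) hnom hfin (hA.nominal.finite_supp (h q))).subset ?_
    rintro _ ⟨a, qs, H, rfl⟩
    exact ⟨a, qs, fun i => (hsupp (qs i)).symm.trans_subset (hA.supp_nu H i), rfl⟩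

/-- Every orbit-finite nominal set is a support-preserving quotient of a strong nominal set with
the same number of orbits. -/
theorem exists_strong_cover (hQ : IsNominal 𝔸 Q) [Finite (Orbits 𝔸 Q)] :
    ∃ (n : Fin (Nat.card (Orbits 𝔸 Q)) → ℕ) (h : Strong 𝔸 (fun i => Fin (n i)) → Q),
      h.Surjective ∧ (∀ (π : FinPerm 𝔸) q, h (π • q) = π • h q) ∧
        ∀ q, supp 𝔸 (h q) = supp 𝔸 q := by
  let σ := Finite.equivFin (Orbits 𝔸 Q)
  let rep : Fin (Nat.card (Orbits 𝔸 Q)) → Q := fun i => (σ.symm i).out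
  have hrep : ∀ q : Q, ∃ i, ∃ π : FinPerm 𝔸, π • rep i = q := by
    intro q
    refine ⟨σ (Quotient.mk _ q), ?_⟩
    have : (Quotient.mk _ q : Orbits 𝔸 Q) = Quotient.mk _ (rep (σ (Quotient.mk _ q))) := by
      simp [rep]
    exact Quotient.exact (s := MulAction.orbitRel (FinPerm 𝔸) Q) this
  -- The index set of each summand enumerates the support of the orbit representative, so that
  -- supports are preserved.
  have he : ∀ i, ∃ (m : ℕ) (e : Fin m ↪ 𝔸), Set.range e = supp 𝔸 (rep i) := by
    intro i
    have := (hQ.finite_supp (rep i)).to_subtype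
    obtain ⟨m, ⟨e⟩⟩ := Finite.exists_equiv_fin (supp 𝔸 (rep i))
    refine ⟨m, e.symm.toEmbedding.trans (Function.Embedding.subtype _), ?_⟩
    ext a
    constructor
    · rintro ⟨x, rfl⟩
      exact (e.symm x).2
    · exact fun ha => ⟨e ⟨a, ha⟩, by simp⟩
  choose n e he using he
  have hex : ∀ q : Strong 𝔸 (fun i => Fin (n i)), ∃ π : FinPerm 𝔸, ∀ x, π • e q.1 x = q.2 x :=
    fun q => exists_smul_eq_of_injective (e q.1).injective q.2.injective
  choose ρ hρ using hex
  -- The chosen `ρ q` is immaterial: permutations agreeing on the support of `rep q.1` act alike on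
  -- it. Equivariance and surjectivity follow.
  have key : ∀ (q : Strong 𝔸 (fun i => Fin (n i))) (π : FinPerm 𝔸),
      (∀ x, π • e q.1 x = q.2 x) → ρ q • rep q.1 = π • rep q.1 := by
    intro q π hπ
    rw [← inv_smul_eq_iff, ← mul_smul]
    refine smul_eq_of_forall_mem_supp _ fun a ha => ?_
    rw [← he] at ha
    obtain ⟨x, rfl⟩ := ha
    rw [mul_smul, hρ, ← hπ, inv_smul_smul]
  refine ⟨n, fun q => ρ q • rep q.1, ?_, ?_, ?_⟩
  · intro q
    obtain ⟨i, π, rfl⟩ := hrep q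
    exact ⟨⟨i, π • e i⟩, key ⟨i, π • e i⟩ π fun _ => rfl⟩
  · intro π q
    have := key (π • q) (π * ρ q) fun x => by
      rw [mul_smul]
      exact congrArg (π • ·) (hρ q x)
    rw [← mul_smul]
    exact this
  · intro q
    rw [supp_smul, supp_strong, ← he, ← Set.range_comp]
    exact congrArg Set.range (funext fun x => hρ q x)

end Pullback

end NomTree

open NomTree in
theorem mainTheorem3 {𝔸 : Type*} [Countable 𝔸] [Infinite 𝔸] {F : Type*} [Finite F] (ar : F → ℕ) :
    (∀ {I : Type*} (X : I → Type*) [∀ i, Finite (X i)] (A : TreeAut 𝔸 ar (Strong 𝔸 X)),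
      A.IsRNTA →
        A.nameDrop.IsRNTA ∧
        A.nameDrop.lang = alphaClosure A.lang ∧
        A.nameDrop.alphaLang = A.alphaLang ∧
        ∃ d : ℕ, HasDegree 𝔸 (Strong 𝔸 X) d ∧ HasDegree 𝔸 (Partial 𝔸 X) d ∧
          Nat.card (Orbits 𝔸 (Partial 𝔸 X)) ≤ 2 ^ d * Nat.card (Orbits 𝔸 (Strong 𝔸 X))) ∧
    (∀ {Q : Type*} [MulAction (FinPerm 𝔸) Q] (A : TreeAut 𝔸 ar Q),
      A.IsRNTA →
        ∃ (k : ℕ) (n : Fin k → ℕ) (A' : TreeAut 𝔸 ar (Strong 𝔸 fun i => Fin (n i))),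
          A'.IsRNTA ∧ A'.lang = A.lang ∧
          A'.nameDrop.IsRNTA ∧
          A'.nameDrop.lang = alphaClosure A.lang ∧
          A'.nameDrop.alphaLang = A.alphaLang ∧
          ∃ d : ℕ, HasDegree 𝔸 Q d ∧ HasDegree 𝔸 (Partial 𝔸 fun i => Fin (n i)) d ∧
            Nat.card (Orbits 𝔸 (Partial 𝔸 fun i => Fin (n i))) ≤
              2 ^ d * Nat.card (Orbits 𝔸 Q)) := by
  constructor
  · intro I X _ A hA
    have := hA.orbitFinite
    -- Every summand is nonempty, so orbit-finiteness forces finitely many indices.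
    have : Finite I := Finite.of_surjective _ (orbitIndex_surjective (𝔸 := 𝔸) (X := X))
    have : Nonempty I := ⟨A.init.1⟩
    obtain ⟨d, hd⟩ := exists_hasDegree_strong (𝔸 := 𝔸) (X := X)
    exact ⟨nameDrop_isRNTA hA, nameDrop_lang hA, nameDrop_alphaLang hA, d, hd, hd.partial,
      (orbits_partial (card_le_of_hasDegree hd)).2.trans (Nat.mul_le_mul_left _
        (Nat.card_le_card_of_surjective _ (orbitIndex_surjective (𝔸 := 𝔸) (X := X))))⟩
  · intro Q _ A hA
    have := hA.orbitFinite
    obtain ⟨n, h, hh, hsmul, hsupp⟩ := exists_strong_cover hA.nominal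
    obtain ⟨q₀, hq₀⟩ := hh A.init
    have : Finite (Orbits 𝔸 (Strong 𝔸 fun i => Fin (n i))) := finite_orbits_strong
    have hA' : (A.pullback h q₀).IsRNTA := hA.pullback q₀ isNominal_strong
      (fun S hS => finite_supp_subset_strong hS) hsmul hsupp
    have hlang := A.pullback_lang hh hq₀
    have : Nonempty (Fin (Nat.card (Orbits 𝔸 Q))) := ⟨q₀.1⟩
    obtain ⟨d, hd⟩ := exists_hasDegree_strong (𝔸 := 𝔸) (X := fun i => Fin (n i))
    refine ⟨_, n, A.pullback h q₀, hA', hlang, nameDrop_isRNTA hA', ?_, ?_, d,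
      hasDegree_of_surjective hh hsupp hd, hd.partial, ?_⟩
    · rw [nameDrop_lang hA', hlang]
    · rw [nameDrop_alphaLang hA', TreeAut.alphaLang, hlang, TreeAut.alphaLang]
    -- The summands of the cover are indexed by the orbits of `Q`.
    · simpa using (orbits_partial (card_le_of_hasDegree hd)).2
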